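/- **Network self-test of Bell states and of the Bell-state measurement in the bilocality scenario.** Let $\mathcal H_A,\mathcal H_{B_1},\mathcal H_{B_2},\mathcal H_C$ be finite-dimensional complex Hilbert spaces. Two independent sources prepare density operators $\rho_{AB_1}$ on $\mathcal H_A\otimes\mathcal H_{B_1}$ and $\sigma_{B_2C}$ on $\mathcal H_{B_2}\otimes\mathcal H_C$. For $x,z\in\{0,1\}$ let $(A_x^{\alpha})_{\alpha\in\{0,1\}}$ and $(C_z^{\gamma})_{\gamma\in\{0,1\}}$ be two-outcome measurements (POVMs) on $\mathcal H_A$ and $\mathcal H_C$, and let $(B^b)_{b=(b_0,b_1)\in\{0,1\}^2}$ be a four-outcome POVM on $\mathcal H_{B_1}\otimes\mathcal H_{B_2}$. Put $$p(\alpha,b,\gamma|x,z)=\mathrm{Tr}\big[(\rho_{AB_1}\otimes\sigma_{B_2C})\,(A_x^{\alpha}\otimes B^b\otimes C_z^{\gamma})\big],\qquad p(b)=\mathrm{Tr}\big[(\rho_{AB_1}\otimes\sigma_{B_2C})\,(\mathbb 1_A\otimes B^b\otimes \mathbb 1_C)\big],$$ suppose $p(b)>0$ for every $b$, and let $$\langle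 A_xC_z\rangle_b=\sum_{\alpha,\gamma}(-1)^{\alpha+\gamma}\,\frac{p(\alpha,b,\gamma|x,z)}{p(b)} .$$ Let $\delta$ be a real number with $0<|\delta|\le \pi/6$ and suppose that for every $b=(b_0,b_1)$ $$\langle A_0C_1\rangle_b=(-1)^{b_0}\cos\delta,\quad \langle A_1C_0\rangle_b=(-1)^{b_1}\cos\delta,\quad \langle A_0C_0\rangle_b=0,\quad \langle A_1C_1\rangle_b=\delta_{b_0,b_1}(-1)^{b_0}\sin(2\delta),$$ where $\delta_{b_0,b_1}$ is the Kronecker symbol. Let $|\Phi^{b}\rangle=\tfrac1{\sqrt2}\big(|0,b_0\rangle+(-1)^{b_1}|1,1-b_0\rangle\big)$ be the Bell states, and $|\Phi^+\rangle=|\Phi^{(0,0)}\rangle$. Then: 1. There are completely positive unital maps $\mathcal C_1:\mathcal L(\mathcal H_{B_1})\to\mathcal L(\mathbb C^2)$ and $\mathcal C_2:\mathcal L(\mathcal H_{B_2})\to\mathcal L(\mathbb C^2)$ with $(\mathcal C_1\otimes\mathcal C_2)(B^b)=|\Phi^b\rangle\langle\Phi^b|$ for all four $b$. 2. There are local maps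 $\mathcal L_1$, acting on $A$ and $B_1$, and $\mathcal L_2$, acting on $B_2$ and $C$, each a tensor product of one completely positive trace-preserving map per party with output a qubit together with a finite-dimensional junk system, such that $$\mathcal L_1(\rho_{AB_1})=|\Phi^+\rangle\langle\Phi^+|_{A'B_1'}\otimes\rho_{\mathrm{junk}},\qquad \mathcal L_2(\sigma_{B_2C})=|\Phi^+\rangle\langle\Phi^+|_{B_2'C'}\otimes\rho'_{\mathrm{junk}}$$ for some density operators $\rho_{\mathrm{junk}},\rho'_{\mathrm{junk}}$ of the junk systems. -/

import Mathlib

open scoped Kronecker ComplexOrder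

namespace Bilocal

noncomputable section

/-- Density operator: positive semidefinite with unit trace. -/
structure IsDensity {n : Type*} [Fintype n] (ρ : Matrix n n ℂ) : Prop where
  posSemidef : ρ.PosSemidef
  trace_eq_one : ρ.trace = 1

/-- Quantum measurement (POVM) with outcomes in `o`; no projectivity is required. -/
structure IsPOVM {o n : Type*} [Fintype o] [Fintype n] [DecidableEq n]
    (M : o → Matrix n n ℂ) : Prop where
  posSemidef : ∀ k, (M k).PosSemidef
  sum_eq_one : ∑ k, M k = 1

/-- The operator `A ⊗ B ⊗ C` on `H_A ⊗ (H_B₁ ⊗ H_B₂) ⊗ H_C`, written with the tensor factors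
grouped by source, as `(H_A ⊗ H_B₁) ⊗ (H_B₂ ⊗ H_C)`. -/
def jointEffect {a b₁ b₂ c : Type*} (A : Matrix a a ℂ) (B : Matrix (b₁ × b₂) (b₁ × b₂) ℂ)
    (C : Matrix c c ℂ) : Matrix ((a × b₁) × (b₂ × c)) ((a × b₁) × (b₂ × c)) ℂ :=
  Matrix.of fun i j =>
    A i.1.1 j.1.1 * B (i.1.2, i.2.1) (j.1.2, j.2.1) * C i.2.2 j.2.2

/-- Born rule for two independent sources:
`Tr[(ρ_{A B₁} ⊗ σ_{B₂ C}) (A ⊗ B ⊗ C)]`. -/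
def born {a b₁ b₂ c : Type*} [Fintype a] [Fintype b₁] [Fintype b₂] [Fintype c]
    (ρ : Matrix (a × b₁) (a × b₁) ℂ) (σ : Matrix (b₂ × c) (b₂ × c) ℂ)
    (A : Matrix a a ℂ) (B : Matrix (b₁ × b₂) (b₁ × b₂) ℂ) (C : Matrix c c ℂ) : ℝ :=
  ((ρ ⊗ₖ σ) * jointEffect A B C).trace.re

/-- Probability `p(b)` of the central outcome with effect `B`. -/
def centralProb {a b₁ b₂ c : Type*} [Fintype a] [Fintype b₁] [Fintype b₂] [Fintype c]
    [DecidableEq a] [DecidableEq c]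
    (ρ : Matrix (a × b₁) (a × b₁) ℂ) (σ : Matrix (b₂ × c) (b₂ × c) ℂ)
    (B : Matrix (b₁ × b₂) (b₁ × b₂) ℂ) : ℝ :=
  born ρ σ 1 B 1

/-- Postselected correlator `⟨A C⟩_b = ∑_{α, γ} (-1)^(α + γ) p(α, γ | b)` of two dichotomic
measurements `A`, `C`, conditioned on the central outcome with effect `B`. -/
def correlator {a b₁ b₂ c : Type*} [Fintype a] [Fintype b₁] [Fintype b₂] [Fintype c]
    [DecidableEq a] [DecidableEq c]
    (ρ : Matrix (a × b₁) (a × b₁) ℂ) (σ : Matrix (b₂ × c) (b₂ × c) ℂ)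
    (A : Fin 2 → Matrix a a ℂ) (B : Matrix (b₁ × b₂) (b₁ × b₂) ℂ)
    (C : Fin 2 → Matrix c c ℂ) : ℝ :=
  ∑ α : Fin 2, ∑ γ : Fin 2,
    (-1 : ℝ) ^ ((α : ℕ) + (γ : ℕ)) * (born ρ σ (A α) B (C γ) / centralProb ρ σ B)

/-- Bell vectors `|Φ^(b₀,b₁)⟩ = (|0, b₀⟩ + (-1)^b₁ |1, 1 - b₀⟩) / √2`: the labels
`(0,0)`, `(1,0)`, `(0,1)`, `(1,1)` give `Φ⁺`, `Ψ⁺`, `Φ⁻`, `Ψ⁻`. Thus `σ_z ⊗ σ_z` has the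
value `(-1)^b₀` and `σ_x ⊗ σ_x` the value `(-1)^b₁`. -/
def bellVec (b : Fin 2 × Fin 2) (i : Fin 2 × Fin 2) : ℂ :=
  if i.2 = i.1 + b.1 then (-1 : ℂ) ^ ((i.1 : ℕ) * (b.2 : ℕ)) / (Real.sqrt 2 : ℂ) else 0

/-- The projector `|Φ^b⟩⟨Φ^b|`. -/
def bellProj (b : Fin 2 × Fin 2) : Matrix (Fin 2 × Fin 2) (Fin 2 × Fin 2) ℂ :=
  Matrix.vecMulVec (bellVec b) (star (bellVec b))

/-- Complete positivity: every amplification `id_k ⊗ Φ` preserves positive semidefiniteness. -/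
def IsCP {n m : Type*} [Fintype n] [Fintype m]
    (Φ : Matrix n n ℂ →ₗ[ℂ] Matrix m m ℂ) : Prop :=
  ∀ (k : ℕ) (X : Matrix (Fin k × n) (Fin k × n) ℂ), X.PosSemidef →
    (Matrix.of fun p q : Fin k × m =>
      Φ (Matrix.of fun i j => X (p.1, i) (q.1, j)) p.2 q.2).PosSemidef

/-- Completely positive and unital map. -/
structure IsCPUnital {n m : Type*} [Fintype n] [Fintype m] [DecidableEq n] [DecidableEq m]
    (Φ : Matrix n n ℂ →ₗ[ℂ] Matrix m m ℂ) : Prop where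
  cp : IsCP Φ
  map_one : Φ 1 = 1

/-- Quantum channel: completely positive and trace-preserving map. -/
structure IsChannel {n m : Type*} [Fintype n] [Fintype m]
    (Φ : Matrix n n ℂ →ₗ[ℂ] Matrix m m ℂ) : Prop where
  cp : IsCP Φ
  trace_map : ∀ X, (Φ X).trace = X.trace

/-- Tensor product `Φ ⊗ Ψ` of two linear maps between matrix algebras, by its values on the
matrix units. -/
def tensorMap {n₁ n₂ m₁ m₂ : Type*} [Fintype n₁] [Fintype n₂] [DecidableEq n₁] [DecidableEq n₂]
    (Φ : Matrix n₁ n₁ ℂ →ₗ[ℂ] Matrix m₁ m₁ ℂ) (Ψ : Matrix n₂ n₂ ℂ →ₗ[ℂ] Matrix m₂ m₂ ℂ)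
    (X : Matrix (n₁ × n₂) (n₁ × n₂) ℂ) : Matrix (m₁ × m₂) (m₁ × m₂) ℂ :=
  ∑ i, ∑ j, ∑ k, ∑ l,
    X (i, k) (j, l) • (Φ (Matrix.single i j 1) ⊗ₖ Ψ (Matrix.single k l 1))

theorem map_eq_sum {n m : Type*} [Fintype n] [DecidableEq n]
    (Φ : Matrix n n ℂ →ₗ[ℂ] Matrix m m ℂ) (X : Matrix n n ℂ) :
    Φ X = ∑ i, ∑ j, X i j • Φ (Matrix.single i j 1) := by
  have h : X = ∑ i, ∑ j, X i j • Matrix.single i j (1 : ℂ) := by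
    conv_lhs => rw [Matrix.matrix_eq_sum_single X]
    simp only [Matrix.smul_single, smul_eq_mul, mul_one]
  conv_lhs => rw [h]
  simp only [map_sum, map_smul]

/-- The defining property `(Φ ⊗ Ψ)(X ⊗ Y) = Φ(X) ⊗ Ψ(Y)`. -/
theorem tensorMap_kronecker {n₁ n₂ m₁ m₂ : Type*} [Fintype n₁] [Fintype n₂]
    [DecidableEq n₁] [DecidableEq n₂]
    (Φ : Matrix n₁ n₁ ℂ →ₗ[ℂ] Matrix m₁ m₁ ℂ) (Ψ : Matrix n₂ n₂ ℂ →ₗ[ℂ] Matrix m₂ m₂ ℂ)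
    (X : Matrix n₁ n₁ ℂ) (Y : Matrix n₂ n₂ ℂ) :
    tensorMap Φ Ψ (X ⊗ₖ Y) = Φ X ⊗ₖ Ψ Y := by
  rw [map_eq_sum Φ X, map_eq_sum Ψ Y]
  ext p q
  simp only [tensorMap, Matrix.sum_apply, Matrix.smul_apply, Matrix.kroneckerMap_apply,
    smul_eq_mul]
  simp only [Finset.sum_mul]
  refine Finset.sum_congr rfl fun i _ => ?_
  refine Finset.sum_congr rfl fun j _ => ?_
  rw [Finset.mul_sum]
  refine Finset.sum_congr rfl fun k _ => ?_
  rw [Finset.mul_sum]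
  refine Finset.sum_congr rfl fun l _ => ?_
  ring

/-- `|Φ⁺⟩⟨Φ⁺| ⊗ τ` with `τ` a junk operator shared by the two sides: the left side holds the
first qubit and the first junk factor, the right side the second qubit and junk factor. -/
def phiPlusJunk {j k : Type*} (τ : Matrix (j × k) (j × k) ℂ) :
    Matrix ((Fin 2 × j) × (Fin 2 × k)) ((Fin 2 × j) × (Fin 2 × k)) ℂ :=
  (bellProj (0, 0) ⊗ₖ τ).submatrix (Equiv.prodProdProdComm (Fin 2) j (Fin 2) k)
    (Equiv.prodProdProdComm (Fin 2) j (Fin 2) k)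

/-- The bipartite state `ρ` is sent to `|Φ⁺⟩⟨Φ⁺| ⊗ τ`, for some junk state `τ`, by a local map,
that is, by a tensor product of one quantum channel on each side. -/
def SelfTestsPhiPlus {l r : Type*} [Fintype l] [Fintype r] [DecidableEq l] [DecidableEq r]
    (ρ : Matrix (l × r) (l × r) ℂ) : Prop :=
  ∃ (j k : ℕ)
    (L : Matrix l l ℂ →ₗ[ℂ] Matrix (Fin 2 × Fin j) (Fin 2 × Fin j) ℂ)
    (R : Matrix r r ℂ →ₗ[ℂ] Matrix (Fin 2 × Fin k) (Fin 2 × Fin k) ℂ)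
    (τ : Matrix (Fin j × Fin k) (Fin j × Fin k) ℂ),
    IsChannel L ∧ IsChannel R ∧ IsDensity τ ∧ tensorMap L R ρ = phiPlusJunk τ

end

end Bilocal

/-!
The proof works with the unnormalised states `Ω b` of the two outer parties conditioned on the
central outcome `b` (`condState`). They are positive, they sum to the product of the reduced states,
and the correlators are expectation values in `Ω b`.

Jordan's lemma (`exists_qubit_blocks`) decomposes the two observables of each outer party, after a
dilation, into qubit blocks in which they are the directions `1` and `t k`, respectively `1` and
`r l`, in an equatorial plane of the Bloch ball. The ideal value of the phases is
`sin δ + i cos δ`. The core of the argument is that every block of nonzero weight is ideal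
(`IsBlockModel.re_eq_sin`). For the outcomes `(0, 0)` and `(1, 1)` the correlations saturate a
quantum bound, and a saturated bound fixes the angle in every block in which these outcomes occur
(`IsBlockModel.re_eq_sin_of_diagonal_outcome`). In the other pairs of blocks only the outcomes
`(0, 1)` and `(1, 0)` occur, so these two outcomes decompose a product state. The mean over all
blocks of suitable combinations of correlators is `1` for the one and `-1` for the other outcome,
whereas the product structure limits the contribution of the pairs of blocks in question
(`planeCorr_sub_le_of_add_eq_kronecker`). That some combination turns this into a contradiction
unless these pairs have weight zero is a scalar inequality (`simplex_witness_bound`), which needs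
the half-angle coordinates to be at least `1 / 2`; this is where `|δ| ≤ π / 6` enters.

With ideal blocks only, the correlators determine the expectation values of `σ_z ⊗ σ_z` and
`σ_x ⊗ σ_x` in the compressed and rotated states, so these are multiples of the Bell projectors
(`eq_smul_bellProj`), and since they sum to a product all weights are `1 / 4`
(`exists_bell_extraction`).

The local maps are given by Kraus operators. The map `M ↦ condState M σ B` acts on the second
half of `ρ` only: it is teleportation with resource `σ`. Followed by the extraction and by a Pauli
correction that depends on the outcome, it is a channel that turns `ρ` into `Φ⁺`
(`selfTestsPhiPlus_left`), and `σ` is treated in the same way (`selfTestsPhiPlus_right`). Read as a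
function of the central effect, `condState ρ σ B` is, up to a transposition, the image of `B` under
a product of completely positive maps; composed with the extraction and scaled by `2` on each side
they are unital, as the extracted qubits are maximally mixed, and they map `B b` to the Bell
projector (`krausMap_liftKraus_kronecker`).
-/

open Matrix

namespace Bilocal

/-! ### Correlations of two qubits in a plane of observables -/

theorem norm_sq_apply_le_of_posSemidef {n : Type*} {M : Matrix n n ℂ}
    (hM : M.PosSemidef) (i j : n) : ‖M i j‖ ^ 2 ≤ (M i i).re * (M j j).re := by
  have h := (hM.submatrix ![i, j]).det_nonneg
  rw [Matrix.det_fin_two] at h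
  have h1 : M j i = star (M i j) := (hM.1.apply i j).symm ▸ by simp
  have h2 : (M i i).im = 0 := (Complex.nonneg_iff.1 hM.diag_nonneg).2.symm
  have h3 : (M j j).im = 0 := (Complex.nonneg_iff.1 hM.diag_nonneg).2.symm
  have h4 := (Complex.nonneg_iff.1 h).1
  simp [h1, h2, h3] at h4
  rw [Complex.sq_norm, Complex.normSq_apply]
  exact h4

theorem diag_re_nonneg {n : Type*} {M : Matrix n n ℂ} (hM : M.PosSemidef) (i : n) :
    0 ≤ (M i i).re := (Complex.nonneg_iff.1 hM.diag_nonneg).1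

/-- The qubit observable `re w • σ_x - im w • σ_y` with coordinate `w` in the plane spanned by
`σ_x` and `σ_y`. -/
def planeObs (w : ℂ) : Matrix (Fin 2) (Fin 2) ℂ := !![0, w; star w, 0]

/-- The expectation value of `planeObs w ⊗ planeObs w'` in the two-qubit operator `M`. -/
def planeCorr (M : Matrix (Fin 2 × Fin 2) (Fin 2 × Fin 2) ℂ) (w w' : ℂ) : ℝ :=
  (M * (planeObs w ⊗ₖ planeObs w')).trace.re

theorem trace_two_qubit (M : Matrix (Fin 2 × Fin 2) (Fin 2 × Fin 2) ℂ) :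
    M.trace = M (0, 0) (0, 0) + M (0, 1) (0, 1) + M (1, 0) (1, 0) + M (1, 1) (1, 1) := by
  simp [Matrix.trace, Fintype.sum_prod_type, add_assoc]

/-- Only the two coherences on the antidiagonal contribute to the correlations of planar
observables. -/
theorem planeCorr_eq {M : Matrix (Fin 2 × Fin 2) (Fin 2 × Fin 2) ℂ} (hM : M.IsHermitian)
    (w w' : ℂ) :
    planeCorr M w w' =
      2 * (M (1, 1) (0, 0) * (w * w')).re + 2 * (M (1, 0) (0, 1) * (w * star w')).re := by
  have h1 : M (0, 0) (1, 1) = star (M (1, 1) (0, 0)) := (hM.apply _ _).symm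
  have h2 : M (0, 1) (1, 0) = star (M (1, 0) (0, 1)) := (hM.apply _ _).symm
  simp only [planeCorr, Matrix.trace, Matrix.diag, Matrix.mul_apply, Fintype.sum_prod_type,
    Fin.sum_univ_two, Matrix.kroneckerMap_apply, planeObs, h1, h2]
  simp
  ring

theorem planeCorr_add_left (M : Matrix (Fin 2 × Fin 2) (Fin 2 × Fin 2) ℂ) (w₁ w₂ w' : ℂ) :
    planeCorr M (w₁ + w₂) w' = planeCorr M w₁ w' + planeCorr M w₂ w' := by
  have : planeObs (w₁ + w₂) = planeObs w₁ + planeObs w₂ := by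
    ext i j; fin_cases i <;> fin_cases j <;> simp [planeObs]
  simp [planeCorr, this, Matrix.add_kronecker, Matrix.mul_add]

theorem planeCorr_add_right (M : Matrix (Fin 2 × Fin 2) (Fin 2 × Fin 2) ℂ) (w w₁ w₂ : ℂ) :
    planeCorr M w (w₁ + w₂) = planeCorr M w w₁ + planeCorr M w w₂ := by
  have : planeObs (w₁ + w₂) = planeObs w₁ + planeObs w₂ := by
    ext i j; fin_cases i <;> fin_cases j <;> simp [planeObs]
  simp [planeCorr, this, Matrix.kronecker_add, Matrix.mul_add]

theorem planeObs_real_mul (a : ℝ) (w : ℂ) : planeObs (a * w) = (a : ℂ) • planeObs w := by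
  ext i j; fin_cases i <;> fin_cases j <;> simp [planeObs]

theorem planeCorr_real_mul_left (M : Matrix (Fin 2 × Fin 2) (Fin 2 × Fin 2) ℂ) (a : ℝ)
    (w w' : ℂ) : planeCorr M (a * w) w' = a * planeCorr M w w' := by
  simp [planeCorr, planeObs_real_mul, Matrix.smul_kronecker]

theorem planeCorr_real_mul_right (M : Matrix (Fin 2 × Fin 2) (Fin 2 × Fin 2) ℂ) (a : ℝ)
    (w w' : ℂ) : planeCorr M w (a * w') = a * planeCorr M w w' := by
  simp [planeCorr, planeObs_real_mul, Matrix.kronecker_smul]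

theorem two_mul_norm_apply_le_of_posSemidef {n : Type*} {M : Matrix n n ℂ}
    (hM : M.PosSemidef) (i j : n) : 2 * ‖M i j‖ ≤ (M i i).re + (M j j).re := by
  have h := norm_sq_apply_le_of_posSemidef hM i j
  have h1 := diag_re_nonneg hM i
  have h2 := diag_re_nonneg hM j
  refine abs_le_of_sq_le_sq' ?_ (by positivity) |>.2
  nlinarith [sq_nonneg ((M i i).re - (M j j).re)]

theorem planeCorr_le {M : Matrix (Fin 2 × Fin 2) (Fin 2 × Fin 2) ℂ} (hM : M.PosSemidef)
    (w w' : ℂ) : planeCorr M w w' ≤ ‖w‖ * ‖w'‖ * M.trace.re := by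
  rw [planeCorr_eq hM.1, trace_two_qubit]
  have a1 := Complex.re_le_norm (M (1, 1) (0, 0) * (w * w'))
  have a2 := Complex.re_le_norm (M (1, 0) (0, 1) * (w * star w'))
  rw [norm_mul, norm_mul] at a1 a2
  rw [norm_star] at a2
  have b1 := two_mul_norm_apply_le_of_posSemidef hM (1, 1) (0, 0)
  have b2 := two_mul_norm_apply_le_of_posSemidef hM (1, 0) (0, 1)
  have hw : 0 ≤ ‖w‖ * ‖w'‖ := by positivity
  simp only [Complex.add_re]
  nlinarith [mul_le_mul_of_nonneg_right b1 hw, mul_le_mul_of_nonneg_right b2 hw]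

theorem neg_planeCorr_le {M : Matrix (Fin 2 × Fin 2) (Fin 2 × Fin 2) ℂ} (hM : M.PosSemidef)
    (w w' : ℂ) : -planeCorr M w w' ≤ ‖w‖ * ‖w'‖ * M.trace.re := by
  have h := planeCorr_le hM (((-1 : ℝ) : ℂ) * w) w'
  rw [planeCorr_real_mul_left] at h
  simpa using h

/-- An entry of the difference of two outcome operators is controlled by the diagonal of their
sum, which does not depend on the measurement. -/
theorem norm_sub_apply_le_of_posSemidef {n : Type*} {M₁ M₂ : Matrix n n ℂ}
    (h₁ : M₁.PosSemidef) (h₂ : M₂.PosSemidef) (i j : n) :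
    ‖(M₁ - M₂) i j‖ ^ 2 ≤ ((M₁ + M₂) i i).re * ((M₁ + M₂) j j).re := by
  have a := norm_sq_apply_le_of_posSemidef h₁ i j
  have b := norm_sq_apply_le_of_posSemidef h₂ i j
  have a1 := diag_re_nonneg h₁ i
  have a2 := diag_re_nonneg h₁ j
  have b1 := diag_re_nonneg h₂ i
  have b2 := diag_re_nonneg h₂ j
  have t : ‖(M₁ - M₂) i j‖ ≤ ‖M₁ i j‖ + ‖M₂ i j‖ := norm_sub_le _ _
  have n1 := norm_nonneg (M₁ i j)
  have n2 := norm_nonneg (M₂ i j)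
  -- the Cauchy-Schwarz inequality for the two outcomes
  have cs : 2 * (‖M₁ i j‖ * ‖M₂ i j‖)
      ≤ (M₁ i i).re * (M₂ j j).re + (M₂ i i).re * (M₁ j j).re := by
    refine abs_le_of_sq_le_sq' ?_ (by positivity) |>.2
    have := mul_le_mul a b (by positivity) (by positivity)
    nlinarith [sq_nonneg ((M₁ i i).re * (M₂ j j).re - (M₂ i i).re * (M₁ j j).re)]
  simp only [Matrix.add_apply, Complex.add_re]
  have t2 : ‖(M₁ - M₂) i j‖ ^ 2 ≤ (‖M₁ i j‖ + ‖M₂ i j‖) ^ 2 := by gcongr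
  nlinarith

/-- The hypotheses say that `‖z‖` and `‖z'‖` are `a + b` and `|a - b|`, in some order. -/
theorem norm_add_add_norm_add_le {a b : ℝ} {z z' : ℂ} {q : ℝ} (ha : 0 ≤ a) (hb : 0 ≤ b)
    (hq : q ^ 2 = (a * b) ^ 2) (hz : ‖z‖ ^ 2 = a ^ 2 + b ^ 2 + 2 * q)
    (hz' : ‖z'‖ ^ 2 = a ^ 2 + b ^ 2 - 2 * q) : ‖z‖ + ‖z'‖ ≤ 2 * max a b := by
  have n1 := norm_nonneg z
  have n2 := norm_nonneg z'
  have hm : 0 ≤ max a b := le_max_of_le_left ha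
  refine abs_le_of_sq_le_sq' ?_ (by positivity) |>.2
  have hp : (‖z‖ * ‖z'‖) = |a ^ 2 - b ^ 2| := by
    rw [← abs_of_nonneg (mul_nonneg n1 n2), ← sq_eq_sq_iff_abs_eq_abs, mul_pow, hz, hz']
    nlinarith
  rcases le_total a b with h | h
  · rw [max_eq_right h]
    rw [abs_of_nonpos (by nlinarith)] at hp
    nlinarith
  · rw [max_eq_left h]
    rw [abs_of_nonneg (by nlinarith)] at hp
    nlinarith

/-- Two outcomes that decompose a product state cannot both be correlated perfectly with two
complementary pairs of observables: only the better of the two pairs counts. In the eigenbasis of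
`σ_z ⊗ σ_z` the witness couples `(0, 0)` to `(1, 1)` and `(0, 1)` to `(1, 0)` only, and the
corresponding entries of the two outcome operators are bounded by the geometric mean
`√(R₀₀ R₁₁ S₀₀ S₁₁)` of diagonal entries of the product state. -/
theorem planeCorr_sub_le_of_add_eq_kronecker {M₁ M₂ : Matrix (Fin 2 × Fin 2) (Fin 2 × Fin 2) ℂ}
    (h₁ : M₁.PosSemidef) (h₂ : M₂.PosSemidef) {R S : Matrix (Fin 2) (Fin 2) ℂ}
    (hR : R.PosSemidef) (hS : S.PosSemidef) (h : M₁ + M₂ = R ⊗ₖ S)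
    {α β : ℝ} (hα : 0 ≤ α) (hβ : 0 ≤ β) {w₁ w₂ w₁' w₂' : ℂ}
    (hw : (w₁ * star w₂).re = 0) (hw' : (w₁' * star w₂').re = 0) :
    α * (planeCorr M₁ w₁ w₁' - planeCorr M₂ w₁ w₁')
        + β * (planeCorr M₁ w₂ w₂' - planeCorr M₂ w₂ w₂')
      ≤ R.trace.re * S.trace.re * max (α * (‖w₁‖ * ‖w₁'‖)) (β * (‖w₂‖ * ‖w₂'‖)) := by
  set K := M₁ - M₂ with hK
  set z := α * (w₁ * w₁') + β * (w₂ * w₂') with hz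
  set z' := α * (w₁ * star w₁') + β * (w₂ * star w₂') with hz'
  have hsum : ‖z‖ + ‖z'‖ ≤ 2 * max (α * (‖w₁‖ * ‖w₁'‖)) (β * (‖w₂‖ * ‖w₂'‖)) := by
    refine norm_add_add_norm_add_le (q := -α * β * (w₁ * star w₂).im * (w₁' * star w₂').im)
      (by positivity) (by positivity) ?_ ?_ ?_
    · have e1 : ‖w₁ * star w₂‖ ^ 2 = (w₁ * star w₂).im ^ 2 := by
        rw [Complex.sq_norm, Complex.normSq_apply, hw]; ring
      have e2 : ‖w₁' * star w₂'‖ ^ 2 = (w₁' * star w₂').im ^ 2 := by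
        rw [Complex.sq_norm, Complex.normSq_apply, hw']; ring
      rw [norm_mul, norm_star] at e1 e2
      calc _ = (α * β) ^ 2 * ((w₁ * star w₂).im ^ 2 * (w₁' * star w₂').im ^ 2) := by ring
        _ = _ := by rw [← e1, ← e2]; ring
    all_goals
      simp only [mul_pow, Complex.sq_norm]
      simp only [hz, hz', Complex.normSq_apply, Complex.star_def, Complex.mul_re, Complex.mul_im,
        Complex.conj_re, Complex.conj_im, Complex.add_re, Complex.add_im, Complex.ofReal_re,
        Complex.ofReal_im]
        at hw hw' ⊢
      linear_combination (2 * α * β * (w₁'.re * w₂'.re + w₁'.im * w₂'.im)) * hw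
  have hR0 := diag_re_nonneg hR 0
  have hR1 := diag_re_nonneg hR 1
  have hS0 := diag_re_nonneg hS 0
  have hS1 := diag_re_nonneg hS 1
  have hRS : ∀ i k, ((R ⊗ₖ S) (i, k) (i, k)).re = (R i i).re * (S k k).re := fun i k => by
    have := (Complex.nonneg_iff.1 (hR.diag_nonneg (i := i))).2.symm
    simp [this]
  have htR : R.trace.re = (R 0 0).re + (R 1 1).re := by simp [Matrix.trace_fin_two]
  have htS : S.trace.re = (S 0 0).re + (S 1 1).re := by simp [Matrix.trace_fin_two]
  have entry : ∀ x : ℝ, 0 ≤ x →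
      x ^ 2 ≤ ((R 0 0).re * (R 1 1).re) * ((S 0 0).re * (S 1 1).re) →
      4 * x ≤ R.trace.re * S.trace.re := fun x hx hle => by
    rw [htR, htS]
    refine abs_le_of_sq_le_sq' ?_ (by positivity) |>.2
    have p1 : 4 * ((R 0 0).re * (R 1 1).re) ≤ ((R 0 0).re + (R 1 1).re) ^ 2 := by
      nlinarith [sq_nonneg ((R 0 0).re - (R 1 1).re)]
    have p2 : 4 * ((S 0 0).re * (S 1 1).re) ≤ ((S 0 0).re + (S 1 1).re) ^ 2 := by
      nlinarith [sq_nonneg ((S 0 0).re - (S 1 1).re)]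
    have := mul_le_mul p1 p2 (by positivity) (by positivity)
    nlinarith
  have k1 := entry _ (norm_nonneg (K (1, 1) (0, 0))) (by
    have := norm_sub_apply_le_of_posSemidef h₁ h₂ (1, 1) (0, 0)
    rw [h, hRS, hRS] at this
    linarith)
  have k2 := entry _ (norm_nonneg (K (1, 0) (0, 1))) (by
    have := norm_sub_apply_le_of_posSemidef h₁ h₂ (1, 0) (0, 1)
    rw [h, hRS, hRS] at this
    linarith)
  have e : α * (planeCorr M₁ w₁ w₁' - planeCorr M₂ w₁ w₁')
        + β * (planeCorr M₁ w₂ w₂' - planeCorr M₂ w₂ w₂')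
      = 2 * (K (1, 1) (0, 0) * z).re + 2 * (K (1, 0) (0, 1) * z').re := by
    simp only [planeCorr_eq h₁.1, planeCorr_eq h₂.1, hK, hz, hz', Matrix.sub_apply, Complex.mul_re,
      Complex.mul_im, Complex.sub_re, Complex.sub_im, Complex.add_re, Complex.add_im,
      Complex.ofReal_re, Complex.ofReal_im]
    ring
  have a1 := Complex.re_le_norm (K (1, 1) (0, 0) * z)
  have a2 := Complex.re_le_norm (K (1, 0) (0, 1) * z')
  rw [norm_mul] at a1 a2
  have t0 : 0 ≤ R.trace.re * S.trace.re := by rw [htR, htS]; positivity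
  rw [e]
  nlinarith [mul_le_mul_of_nonneg_right k1 (norm_nonneg z),
    mul_le_mul_of_nonneg_right k2 (norm_nonneg z'), mul_le_mul_of_nonneg_left hsum t0]

/-! ### A scalar inequality for the weights of the witnesses -/

theorem cubic_le_affine {q : ℝ} (h0 : 0 ≤ q) (h1 : q ≤ 1) :
    q * (1.386 - 0.462 * q) ^ 2 ≤ 0.53 + 0.47 * q := by
  nlinarith [mul_nonneg (mul_nonneg h0 h0) (sub_nonneg.2 h1), sq_nonneg (q - 0.68)]

/-- The scalar inequality behind the uniqueness of the ideal blocks. The weights `P` and `Q` are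
those of the nonideal blocks, split according to the two coordinates of their directions, and
`(S, C)` is the direction of a block of the other party. Tilting the witness by
`(Q - P) / 10` keeps its value at most `1`, whatever the direction `(S, C)`. -/
theorem simplex_witness_bound {P Q X Y S C : ℝ} (hP : 0 ≤ P) (hQ : 0 ≤ Q) (hPQ : P + Q ≤ 1)
    (hS : 0 ≤ S) (hC : 0 ≤ C) (hSC : S ^ 2 + C ^ 2 = 1)
    (hX : X = (1 / 2 + (Q - P) / 10) * S) (hY : Y = (1 / 2 - (Q - P) / 10) * C) :
    (1 - P - Q) * max (2 * X) (1.415 * Y)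
      + 2.31 * (P * max X (Y / 2) + Q * max Y (X / 2)) ≤ 1 := by
  have hS1 : S ≤ 1 := by nlinarith
  have hC1 : C ≤ 1 := by nlinarith
  have hX0 : 0 ≤ X := by rw [hX]; apply mul_nonneg <;> linarith
  have hY0 : 0 ≤ Y := by rw [hY]; apply mul_nonneg <;> linarith
  have hXα : X ≤ 1 / 2 + (Q - P) / 10 := by rw [hX]; nlinarith
  have hYβ : Y ≤ 1 / 2 - (Q - P) / 10 := by rw [hY]; nlinarith
  rcases le_total (2 * Y) X with h1 | h1
  · rw [max_eq_left (by linarith), max_eq_left (by linarith), max_eq_right (by linarith)]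
    have key : (1 / 2 + (Q - P) / 10) * (2 * (1 - P - Q) + 2.31 * P + 1.155 * Q) ≤ 1 := by
      nlinarith [mul_nonneg hP hQ]
    have : X * (2 * (1 - P - Q) + 2.31 * P + 1.155 * Q)
        ≤ (1 / 2 + (Q - P) / 10) * (2 * (1 - P - Q) + 2.31 * P + 1.155 * Q) :=
      mul_le_mul_of_nonneg_right hXα (by linarith)
    linarith
  rcases le_total (2 * X) Y with h2 | h2
  · rw [max_eq_right (by linarith), max_eq_right (by linarith), max_eq_left (by linarith)]
    have key : (1 / 2 - (Q - P) / 10) * (1.415 * (1 - P - Q) + 1.155 * P + 2.31 * Q) ≤ 1 := by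
      nlinarith [mul_nonneg hP hQ, mul_nonneg hP (sub_nonneg.2 hPQ),
        mul_nonneg hQ (sub_nonneg.2 hPQ)]
    have : Y * (1.415 * (1 - P - Q) + 1.155 * P + 2.31 * Q)
        ≤ (1 / 2 - (Q - P) / 10) * (1.415 * (1 - P - Q) + 1.155 * P + 2.31 * Q) :=
      mul_le_mul_of_nonneg_right hYβ (by linarith)
    linarith
  rw [max_eq_left (show Y / 2 ≤ X by linarith), max_eq_left (show X / 2 ≤ Y by linarith)]
  -- in the intermediate regime both branches are bounded by the Cauchy-Schwarz inequality
  have cs : ∀ a b : ℝ, a ^ 2 + b ^ 2 ≤ 1 → a * S + b * C ≤ 1 := fun a b hab => by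
    nlinarith [sq_nonneg (a - S), sq_nonneg (b - C)]
  have hR : 0 ≤ 1 - P - Q := by linarith
  have hQ1 : Q ≤ 1 := by linarith
  have hP1 : P ≤ 1 := by linarith
  rcases le_total (1.415 * Y) (2 * X) with h3 | h3
  · rw [max_eq_left h3]
    have hA0 : 0 ≤ (1 / 2 + (Q - P) / 10) * (2 * (1 - P - Q) + 2.31 * P) :=
      mul_nonneg (by linarith) (by linarith)
    have hB0 : 0 ≤ (1 / 2 - (Q - P) / 10) * (2.31 * Q) := mul_nonneg (by linarith) (by linarith)
    have hA : (1 / 2 + (Q - P) / 10) * (2 * (1 - P - Q) + 2.31 * P)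
        ≤ (1 - Q) * (1 + 0.431 * Q) := by
      linarith [mul_nonneg hQ hR, sq_nonneg P]
    have hB : (1 / 2 - (Q - P) / 10) * (2.31 * Q) ≤ Q * (1.386 - 0.462 * Q) := by
      linarith [mul_nonneg hQ hR]
    have hA1 : (1 - Q) * (1 + 0.431 * Q) ≤ 1 := by linarith [sq_nonneg Q]
    have hB1 : Q * (1.386 - 0.462 * Q) ^ 2 ≤ 0.569 + 0.431 * Q :=
      (cubic_le_affine hQ hQ1).trans (by linarith)
    have := cs _ _ (show ((1 / 2 + (Q - P) / 10) * (2 * (1 - P - Q) + 2.31 * P)) ^ 2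
      + ((1 / 2 - (Q - P) / 10) * (2.31 * Q)) ^ 2 ≤ 1 by
        have e1 := pow_le_pow_left₀ hA0 hA 2
        have e2 := pow_le_pow_left₀ hB0 hB 2
        have e3 : ((1 - Q) * (1 + 0.431 * Q)) ^ 2 ≤ (1 - Q) * (1 + 0.431 * Q) := by
          have : 0 ≤ (1 - Q) * (1 + 0.431 * Q) := mul_nonneg (by linarith) (by linarith)
          exact (pow_le_of_le_one this hA1 two_ne_zero)
        linarith [mul_le_mul_of_nonneg_left hB1 hQ])
    rw [hX, hY]
    linarith
  · rw [max_eq_right h3]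
    have hA0 : 0 ≤ (1 / 2 + (Q - P) / 10) * (2.31 * P) := mul_nonneg (by linarith) (by linarith)
    have hB0 : 0 ≤ (1 / 2 - (Q - P) / 10) * (1.415 * (1 - P - Q) + 2.31 * Q) :=
      mul_nonneg (by linarith) (by linarith)
    have hA : (1 / 2 + (Q - P) / 10) * (2.31 * P) ≤ P * (1.386 - 0.462 * P) := by
      linarith [mul_nonneg hP hR]
    have hB : (1 / 2 - (Q - P) / 10) * (1.415 * (1 - P - Q) + 2.31 * Q)
        ≤ (1 - P) * (0.93 + 0.47 * P) := by
      linarith [mul_nonneg hP hR, sq_nonneg (1 - P - Q), mul_nonneg hP (sub_nonneg.2 hP1)]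
    have := cs _ _ (show ((1 / 2 + (Q - P) / 10) * (2.31 * P)) ^ 2
      + ((1 / 2 - (Q - P) / 10) * (1.415 * (1 - P - Q) + 2.31 * Q)) ^ 2 ≤ 1 by
        have e1 := pow_le_pow_left₀ hA0 hA 2
        have e2 := pow_le_pow_left₀ hB0 hB 2
        have hB1 : P * (1.386 - 0.462 * P) ^ 2 ≤ 0.53 + 0.47 * P := cubic_le_affine hP hP1
        have e3 : ((1 - P) * (0.93 + 0.47 * P)) ^ 2 ≤ (1 - P) * (1 + 0.47 * P) := by
          have : 0 ≤ (1 - P) * (0.93 + 0.47 * P) := mul_nonneg (by linarith) (by linarith)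
          have h' : (1 - P) * (0.93 + 0.47 * P) ≤ 1 := by linarith [sq_nonneg P]
          linarith [pow_le_of_le_one this h' two_ne_zero]
        linarith [mul_le_mul_of_nonneg_left hB1 hP])
    rw [hX, hY]
    linarith

/-- On the unit circle `max (a c) (b s)` is bounded by a function that is affine in `c ^ 2`. This
makes it possible to average over blocks knowing only the mean of `c ^ 2`. -/
theorem max_mul_le {a b c s : ℝ} (ha : 0 ≤ a) (hb : 0 ≤ b)
    (h : c ^ 2 + s ^ 2 = 1) :
    max (a * c) (b * s) ≤ c ^ 2 * max a (b / 2) + s ^ 2 * max b (a / 2) := by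
  have h1 := le_max_left a (b / 2)
  have h2 := le_max_right a (b / 2)
  have h3 := le_max_left b (a / 2)
  have h4 := le_max_right b (a / 2)
  apply max_le
  · nlinarith [mul_le_mul_of_nonneg_left h1 (sq_nonneg c),
      mul_le_mul_of_nonneg_left h4 (sq_nonneg s), mul_nonneg ha (sq_nonneg (c - 1))]
  · nlinarith [mul_le_mul_of_nonneg_left h2 (sq_nonneg c),
      mul_le_mul_of_nonneg_left h3 (sq_nonneg s), mul_nonneg hb (sq_nonneg (s - 1))]

/-- Here `v l` is the weight of a block of the second party, `(c l, s l)` are the coordinates of its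
direction, and `z` singles out the ideal blocks, of direction `(n, m)`. If some nonideal block has
positive weight, there is a witness with negative excess in the ideal blocks of the first party,
which have direction `(m, n)`, and with nonpositive excess in its blocks of any direction
`(S, C)`. -/
theorem exists_witness_weights_of_le {L : Type*} [Fintype L] {m n : ℝ} (hm : 1 / 2 ≤ m)
    (hmn : m ≤ n) (h1 : m ^ 2 + n ^ 2 = 1) (v c s : L → ℝ) (hv : ∀ l, 0 ≤ v l)
    (hv1 : ∑ l, v l = 1) (hc : ∀ l, 0 ≤ c l)
    (hcs : ∀ l, c l ^ 2 + s l ^ 2 = 1)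
    (z : L → Prop) [DecidablePred z] (hz : ∀ l, z l → c l = n ∧ s l = m)
    (hne : ∃ l, ¬ z l ∧ 0 < v l) :
    ∃ α β : ℝ, 0 ≤ α ∧ 0 ≤ β ∧ α + β = 1 ∧
      ∑ l, v l * (if z l then 0 else max (α * (m * c l)) (β * (n * s l)) / (m * n) - 1) < 0 ∧
      ∀ S C : ℝ, 0 ≤ S → 0 ≤ C → S ^ 2 + C ^ 2 = 1 →
        ∑ l, v l * (max (α * (S * c l)) (β * (C * s l)) / (m * n) - 1) ≤ 0 := by
  have hm0 : 0 < m := by linarith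
  have hn0 : 0 < n := by linarith
  have hn2 : 1 / 2 ≤ n ^ 2 := by nlinarith
  -- `m` lies between `1 / 2` and `1 / √2`: the constants are `2`, `√2` and `4 / √3`, rounded up
  have hm' : 1 / m ≤ 2 := by rw [div_le_iff₀ hm0]; linarith
  have hn' : 1 / n ≤ 1.415 := by
    rw [div_le_iff₀ hn0]
    nlinarith
  have hmn' : 1 / (m * n) ≤ 2.31 := by
    rw [div_le_iff₀ (by positivity)]
    have hmm : 1 / 4 ≤ m ^ 2 := by nlinarith
    have hmm' : m ^ 2 ≤ 1 / 2 := by nlinarith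
    have : 3 / 16 ≤ (m * n) ^ 2 := by
      rw [mul_pow, show n ^ 2 = 1 - m ^ 2 by linarith]
      nlinarith [mul_nonneg (sub_nonneg.2 hmm) (sub_nonneg.2 hmm')]
    by_contra! hlt
    nlinarith [mul_pos hm0 hn0]
  set P := ∑ l, v l * (if z l then 0 else c l ^ 2) with hP
  set Q := ∑ l, v l * (if z l then 0 else s l ^ 2) with hQ
  have hP0 : 0 ≤ P := Finset.sum_nonneg fun l _ => mul_nonneg (hv l) (by split_ifs <;> positivity)
  have hQ0 : 0 ≤ Q := Finset.sum_nonneg fun l _ => mul_nonneg (hv l) (by split_ifs <;> positivity)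
  have hPQ : P + Q = ∑ l, v l * (if z l then 0 else 1) := by
    rw [hP, hQ, ← Finset.sum_add_distrib]
    refine Finset.sum_congr rfl fun l _ => ?_
    have := hcs l
    split_ifs
    · ring
    · rw [← mul_add, this]
  have hv0 : 1 - P - Q = ∑ l, v l * (if z l then 1 else 0) := by
    have : ∑ l, v l = ∑ l, v l * (if z l then 0 else 1) + ∑ l, v l * (if z l then 1 else 0) := by
      rw [← Finset.sum_add_distrib]
      refine Finset.sum_congr rfl fun l _ => ?_
      split_ifs <;> ring
    linarith
  have hPQ1 : P + Q ≤ 1 := by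
    have : 0 ≤ 1 - P - Q := by
      rw [hv0]
      exact Finset.sum_nonneg fun l _ => mul_nonneg (hv l) (by split_ifs <;> positivity)
    linarith
  have hPQ0 : 0 < P + Q := by
    obtain ⟨l, hl, hl'⟩ := hne
    rw [hPQ]
    refine Finset.sum_pos' (fun l _ => mul_nonneg (hv l) (by split_ifs <;> positivity))
      ⟨l, Finset.mem_univ _, ?_⟩
    simpa [hl] using hl'
  set α := 1 / 2 + (Q - P) / 10 with hα
  set β := 1 / 2 - (Q - P) / 10 with hβ
  have hα0 : 0 ≤ α := by linarith
  have hβ0 : 0 ≤ β := by linarith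
  refine ⟨α, β, hα0, hβ0, by ring, ?_, ?_⟩
  · have hle : ∀ l, v l * (if z l then 0 else
        max (α * (m * c l)) (β * (n * s l)) / (m * n) - 1)
        ≤ (0.85 - 1) * (v l * (if z l then 0 else c l ^ 2))
          + (2 * β - 1) * (v l * (if z l then 0 else s l ^ 2)) := fun l => by
      split_ifs with hl
      · simp
      · have e : max (α * (m * c l)) (β * (n * s l)) / (m * n)
            = max (α * (1 / n) * c l) (β * (1 / m) * s l) := by
          rw [← max_div_div_right (by positivity)]
          congr 1 <;> field_simp
        have b1 : α * (1 / n) ≤ 0.849 := by linarith [mul_le_mul_of_nonneg_left hn' hα0]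
        have b2 : β * (1 / m) ≤ 2 * β := by linarith [mul_le_mul_of_nonneg_left hm' hβ0]
        have b := max_mul_le (a := α * (1 / n)) (b := β * (1 / m)) (by positivity) (by positivity)
          (hcs l)
        have b3 : max (α * (1 / n)) (β * (1 / m) / 2) ≤ 0.85 := max_le (by linarith) (by linarith)
        have b4 : max (β * (1 / m)) (α * (1 / n) / 2) ≤ 2 * β := max_le (by linarith) (by linarith)
        rw [e]
        have b5 := mul_le_mul_of_nonneg_left b3 (sq_nonneg (c l))
        have b6 := mul_le_mul_of_nonneg_left b4 (sq_nonneg (s l))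
        have := hcs l
        have : max (α * (1 / n) * c l) (β * (1 / m) * s l) - 1
          ≤ (0.85 - 1) * c l ^ 2 + (2 * β - 1) * s l ^ 2 := by linarith
        linarith [mul_le_mul_of_nonneg_left this (hv l)]
    refine (Finset.sum_le_sum fun l _ => hle l).trans_lt ?_
    rw [Finset.sum_add_distrib, ← Finset.mul_sum, ← Finset.mul_sum, ← hP, ← hQ, hβ]
    rcases hP0.eq_or_lt with h | h
    · rw [← h] at hPQ0 ⊢
      nlinarith
    · have hP1 : P ≤ 1 := by linarith
      nlinarith [sq_nonneg (P - 2 * Q), mul_nonneg hP0 (sub_nonneg.2 hP1)]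
  · intro S C hS hC hSC
    have key := simplex_witness_bound hP0 hQ0 hPQ1 hS hC hSC rfl rfl
    set X := α * S with hX
    set Y := β * C with hY
    have hX0 : 0 ≤ X := by positivity
    have hY0 : 0 ≤ Y := by positivity
    have hle : ∀ l, v l * (max (α * (S * c l)) (β * (C * s l)) / (m * n) - 1)
        ≤ max (2 * X) (1.415 * Y) * (v l * (if z l then 1 else 0))
          + 2.31 * (max X (Y / 2) * (v l * (if z l then 0 else c l ^ 2))
            + max Y (X / 2) * (v l * (if z l then 0 else s l ^ 2))) - v l := fun l => by
      have e : max (α * (S * c l)) (β * (C * s l)) / (m * n)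
          = max (X * c l) (Y * s l) * (1 / (m * n)) := by
        rw [hX, hY, ← mul_assoc, ← mul_assoc]; ring
      split_ifs with hl
      · obtain ⟨h2, h3⟩ := hz l hl
        have e2 : max (X * c l) (Y * s l) * (1 / (m * n)) = max (X * (1 / m)) (Y * (1 / n)) := by
          rw [max_mul_of_nonneg _ _ (by positivity), h2, h3]
          congr 1 <;> field_simp
        rw [e, e2]
        have : max (X * (1 / m)) (Y * (1 / n)) ≤ max (2 * X) (1.415 * Y) :=
          max_le_max (by linarith [mul_le_mul_of_nonneg_left hm' hX0])
            (by linarith [mul_le_mul_of_nonneg_left hn' hY0])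
        linarith [mul_le_mul_of_nonneg_left this (hv l)]
      · have b := max_mul_le hX0 hY0 (hcs l)
        have b0 : 0 ≤ max (X * c l) (Y * s l) :=
          le_max_of_le_left (mul_nonneg hX0 (hc l))
        have : max (X * c l) (Y * s l) * (1 / (m * n))
            ≤ 2.31 * (c l ^ 2 * max X (Y / 2) + s l ^ 2 * max Y (X / 2)) := by
          linarith [mul_le_mul_of_nonneg_left hmn' b0]
        rw [e]
        linarith [mul_le_mul_of_nonneg_left this (hv l)]
    refine (Finset.sum_le_sum fun l _ => hle l).trans ?_
    rw [Finset.sum_sub_distrib, hv1, Finset.sum_add_distrib, ← Finset.mul_sum, ← Finset.mul_sum,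
      Finset.sum_add_distrib, ← Finset.mul_sum, ← Finset.mul_sum, ← hP, ← hQ, ← hv0]
    linarith

/-- The two coordinates play symmetric roles, so that `m ≤ n` may be assumed. -/
theorem exists_witness_weights {L : Type*} [Fintype L] {m n : ℝ} (hm : 1 / 2 ≤ m)
    (hn : 1 / 2 ≤ n) (h1 : m ^ 2 + n ^ 2 = 1) (v c s : L → ℝ) (hv : ∀ l, 0 ≤ v l)
    (hv1 : ∑ l, v l = 1) (hc : ∀ l, 0 ≤ c l) (hs : ∀ l, 0 ≤ s l)
    (hcs : ∀ l, c l ^ 2 + s l ^ 2 = 1)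
    (z : L → Prop) [DecidablePred z] (hz : ∀ l, z l → c l = n ∧ s l = m)
    (hne : ∃ l, ¬ z l ∧ 0 < v l) :
    ∃ α β : ℝ, 0 ≤ α ∧ 0 ≤ β ∧ α + β = 1 ∧
      ∑ l, v l * (if z l then 0 else max (α * (m * c l)) (β * (n * s l)) / (m * n) - 1) < 0 ∧
      ∀ S C : ℝ, 0 ≤ S → 0 ≤ C → S ^ 2 + C ^ 2 = 1 →
        ∑ l, v l * (max (α * (S * c l)) (β * (C * s l)) / (m * n) - 1) ≤ 0 := by
  rcases le_total m n with h | h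
  · exact exists_witness_weights_of_le hm h h1 v c s hv hv1 hc hcs z hz hne
  · obtain ⟨α, β, hα, hβ, hαβ, hlt, hle⟩ := exists_witness_weights_of_le hn h (by linarith) v s c
      hv hv1 hs (fun l => by linarith [hcs l]) z (fun l hl => (hz l hl).symm) hne
    refine ⟨β, α, hβ, hα, by linarith, ?_, fun S C hS hC hSC => ?_⟩
    · simpa only [max_comm, mul_comm n m] using hlt
    · simpa only [max_comm, mul_comm n m] using hle C S hC hS (by linarith)

/-- Product weights for which every witness has nonnegative excess outside the distinguished
block have no weight outside it, on the second side. -/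
theorem weights_eq_zero_of_witness {K L : Type*} [Fintype K] [Fintype L] {m n : ℝ}
    (hm : 1 / 2 ≤ m) (hn : 1 / 2 ≤ n) (h1 : m ^ 2 + n ^ 2 = 1)
    (u a b : K → ℝ) (hu : ∀ k, 0 ≤ u k) (ha : ∀ k, 0 ≤ a k) (hb : ∀ k, 0 ≤ b k)
    (hab : ∀ k, a k ^ 2 + b k ^ 2 = 1)
    (y : K → Prop) [DecidablePred y] (hy : ∀ k, y k → a k = m ∧ b k = n)
    (hyu : ∃ k, y k ∧ 0 < u k)
    (v c s : L → ℝ) (hv : ∀ l, 0 ≤ v l)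
    (hv1 : ∑ l, v l = 1) (hc : ∀ l, 0 ≤ c l) (hs : ∀ l, 0 ≤ s l)
    (hcs : ∀ l, c l ^ 2 + s l ^ 2 = 1)
    (z : L → Prop) [DecidablePred z] (hz : ∀ l, z l → c l = n ∧ s l = m)
    (hW : ∀ α β : ℝ, 0 ≤ α → 0 ≤ β → α + β = 1 →
      0 ≤ ∑ k, ∑ l, u k * v l * (if y k ∧ z l then 0 else
        max (α * (a k * c l)) (β * (b k * s l)) / (m * n) - 1)) (l : L) (hl : ¬ z l) : v l = 0 := by
  by_contra hvl
  obtain ⟨α, β, hα, hβ, hαβ, hlt, hle⟩ := exists_witness_weights hm hn h1 v c s hv hv1 hc hs hcs z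
    hz ⟨l, hl, lt_of_le_of_ne (hv l) (Ne.symm hvl)⟩
  refine absurd (hW α β hα hβ hαβ) (not_le.2 ?_)
  obtain ⟨k₀, hk₀, hk₀'⟩ := hyu
  have hrow : ∀ k, y k → ∑ l, u k * v l * (if y k ∧ z l then 0 else
        max (α * (a k * c l)) (β * (b k * s l)) / (m * n) - 1) = u k * ∑ l, v l *
        (if z l then 0 else max (α * (m * c l)) (β * (n * s l)) / (m * n) - 1) := fun k hk => by
    rw [Finset.mul_sum]
    refine Finset.sum_congr rfl fun l _ => ?_
    simp only [hk, true_and, hy k hk]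
    ring
  refine Finset.sum_neg' (fun k _ => ?_) ⟨k₀, Finset.mem_univ _, ?_⟩
  · by_cases hk : y k
    · rw [hrow k hk]
      exact mul_nonpos_of_nonneg_of_nonpos (hu k) hlt.le
    · simp only [hk, false_and, if_false, mul_assoc]
      rw [← Finset.mul_sum]
      exact mul_nonpos_of_nonneg_of_nonpos (hu k) (hle _ _ (ha k) (hb k) (hab k))
  · rw [hrow k₀ hk₀]
    exact mul_neg_of_pos_of_neg hk₀' hlt

/-! ### Rigidity of the qubit blocks -/

/-- The saturation argument in terms of numbers. In block `i` of weight `q i` the correlators are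
`e`, `f`, `g`, `h`, and `τ i` is the real part of the phase `t` of one party. The bounds `hA` and
`hB` come from the pairs of directions `(t - sin δ, 1)` and `(cos 2δ + t sin δ, r cos δ)`. Their
sum over the blocks is saturated by the total correlations, which leaves `|t - sin δ| = cos δ`,
that is `τ i = sin δ`, in every block of nonzero weight. -/
theorem eq_sin_of_saturation {ι : Type*} [Fintype ι] {δ ε p : ℝ} (hδ0 : Real.sin δ ≠ 0)
    (hC : 0 < Real.cos (2 * δ)) (hε : ε ^ 2 = 1) {q e f g h x τ : ι → ℝ}
    (hq : ∀ i, 0 ≤ q i)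
    (hx2 : ∀ i, x i ^ 2 = 1 - 2 * Real.sin δ * τ i + Real.sin δ ^ 2)
    (hA : ∀ i, ε * (g i - Real.sin δ * e i) ≤ x i * q i)
    (hB : ∀ i, 2 * Real.cos δ * (ε * (Real.cos (2 * δ) * f i + Real.sin δ * h i)) ≤
      (Real.cos δ ^ 2 + Real.cos (2 * δ) ^ 2 + Real.sin δ ^ 2
        + 2 * Real.cos (2 * δ) * Real.sin δ * τ i) * q i)
    (hc : 0 < Real.cos δ)
    (sq : ∑ i, q i = p) (se : ∑ i, e i = 0) (sf : ∑ i, f i = ε * Real.cos δ * p)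
    (sg : ∑ i, g i = ε * Real.cos δ * p) (sh : ∑ i, h i = ε * Real.sin (2 * δ) * p)
    (i : ι) (hqi : q i ≠ 0) : τ i = Real.sin δ := by
  set s := Real.sin δ with hs
  set c := Real.cos δ with hcdef
  set C := Real.cos (2 * δ) with hCdef
  have hcs : s ^ 2 + c ^ 2 = 1 := Real.sin_sq_add_cos_sq δ
  have hC2 : C = 1 - 2 * s ^ 2 := by rw [hCdef, Real.cos_two_mul, ← hcdef]; linarith
  have hS2 : Real.sin (2 * δ) = 2 * s * c := Real.sin_two_mul δ
  rw [hS2] at sh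
  set T := ∑ i, τ i * q i with hT
  -- the sum of `hB` over all blocks bounds `sin δ * T` from below
  have h3 : 2 * c * (ε * (C * (ε * c * p) + s * (ε * (2 * s * c) * p)))
      ≤ (c ^ 2 + C ^ 2 + s ^ 2) * p + 2 * C * s * T := by
    have := Finset.sum_le_sum fun i (_ : i ∈ Finset.univ) => hB i
    have e1 : ∑ i, 2 * c * (ε * (C * f i + s * h i))
        = 2 * c * (ε * (C * ∑ i, f i + s * ∑ i, h i)) := by
      simp only [Finset.mul_sum, Finset.sum_add_distrib, mul_add]
    have e2 : ∑ i, (c ^ 2 + C ^ 2 + s ^ 2 + 2 * C * s * τ i) * q i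
        = (c ^ 2 + C ^ 2 + s ^ 2) * ∑ i, q i + 2 * C * s * T := by
      simp only [hT, Finset.mul_sum, ← Finset.sum_add_distrib]
      exact Finset.sum_congr rfl fun i _ => by ring
    rwa [e1, e2, sf, sh, sq] at this
  have h3' : s ^ 2 * p ≤ s * T := by
    have e1 : 2 * c * (ε * (C * (ε * c * p) + s * (ε * (2 * s * c) * p)))
        = (2 * c ^ 2 * C + 4 * s ^ 2 * c ^ 2) * p := by
      linear_combination (2 * c ^ 2 * C * p + 4 * s ^ 2 * c ^ 2 * p) * hε
    have e2 : 2 * C * (s * T - s ^ 2 * p) = (c ^ 2 + C ^ 2 + s ^ 2) * p + 2 * C * s * T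
        - (2 * c ^ 2 * C + 4 * s ^ 2 * c ^ 2) * p := by
      rw [hC2, show c ^ 2 = 1 - s ^ 2 by linarith]
      ring
    rw [e1] at h3
    by_contra! hlt
    nlinarith
  -- the slack of `2 cos δ * hA` in each block, after the arithmetic-geometric mean inequality;
  -- its total is nonpositive
  set D : ι → ℝ := fun i => (2 - 2 * s * τ i) * q i - 2 * c * (ε * (g i - s * e i)) with hD
  have hDx : ∀ i, (c - x i) ^ 2 * q i ≤ D i := fun i => by
    have := mul_le_mul_of_nonneg_left (hA i) (by positivity : 0 ≤ 2 * c)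
    have e1 : (c - x i) ^ 2 * q i = (2 - 2 * s * τ i) * q i - 2 * c * (x i * q i) := by
      linear_combination (q i) * hx2 i + (q i) * hcs
    rw [hD, e1]
    linarith
  have hD0 : ∀ i, 0 ≤ D i := fun i => le_trans (mul_nonneg (sq_nonneg _) (hq i)) (hDx i)
  have hDs : ∑ i, D i ≤ 0 := by
    have e1 : ∑ i, D i = 2 * ∑ i, q i - 2 * s * T - 2 * c * (ε * (∑ i, g i - s * ∑ i, e i)) := by
      simp only [hD, hT, Finset.mul_sum, ← Finset.sum_sub_distrib]
      exact Finset.sum_congr rfl fun i _ => by ring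
    rw [e1, sq, sg, se]
    have : 2 * c * (ε * (ε * c * p - s * 0)) = 2 * c ^ 2 * p := by
      linear_combination (2 * c ^ 2 * p) * hε
    rw [this, show c ^ 2 = 1 - s ^ 2 by linarith]
    linarith
  have hDi : D i = 0 :=
    (Finset.sum_eq_zero_iff_of_nonneg fun i _ => hD0 i).1
      (le_antisymm hDs (Finset.sum_nonneg fun i _ => hD0 i)) i (Finset.mem_univ i)
  have hqi' : 0 < q i := lt_of_le_of_ne (hq i) (Ne.symm hqi)
  have hcx : (c - x i) ^ 2 = 0 := by
    have := hDx i
    rw [hDi] at this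
    nlinarith [sq_nonneg (c - x i)]
  have hxc : x i = c := by nlinarith [pow_eq_zero_iff (two_ne_zero) |>.1 hcx]
  have h4 := hx2 i
  rw [hxc] at h4
  have : s * (τ i - s) = 0 := by linarith
  rcases mul_eq_zero.1 this with h5 | h5
  · exact absurd h5 hδ0
  · linarith

theorem sign_mul_planeCorr_le {M : Matrix (Fin 2 × Fin 2) (Fin 2 × Fin 2) ℂ} (hM : M.PosSemidef)
    {ε : ℝ} (hε : ε ^ 2 = 1) (w w' : ℂ) :
    ε * planeCorr M w w' ≤ ‖w‖ * ‖w'‖ * M.trace.re := by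
  rcases sq_eq_one_iff.1 hε with rfl | rfl
  · rw [one_mul]
    exact planeCorr_le hM w w'
  · rw [neg_one_mul]
    exact neg_planeCorr_le hM w w'

theorem planeCorr_affine (M : Matrix (Fin 2 × Fin 2) (Fin 2 × Fin 2) ℂ) (x y x' y' : ℝ)
    (t r : ℂ) :
    planeCorr M (x * 1 + y * t) (x' * 1 + y' * r) =
      x * x' * planeCorr M 1 1 + x * y' * planeCorr M 1 r + y * x' * planeCorr M t 1
        + y * y' * planeCorr M t r := by
  simp only [planeCorr_add_left, planeCorr_add_right, planeCorr_real_mul_left,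
    planeCorr_real_mul_right]
  ring

theorem norm_sq_real_add_real_mul {t : ℂ} (ht : ‖t‖ = 1) (x y : ℝ) :
    ‖(x * 1 + y * t : ℂ)‖ ^ 2 = x ^ 2 + y ^ 2 + 2 * x * y * t.re := by
  have h : t.re ^ 2 + t.im ^ 2 = 1 := by
    have := Complex.sq_norm t
    rw [ht, Complex.normSq_apply] at this
    linarith
  rw [Complex.sq_norm, Complex.normSq_apply]
  simp
  linear_combination y ^ 2 * h

theorem re_le_one_of_norm_eq_one {t : ℂ} (ht : ‖t‖ = 1) : t.re ≤ 1 :=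
  ht ▸ Complex.re_le_norm t

theorem neg_one_le_re_of_norm_eq_one {t : ℂ} (ht : ‖t‖ = 1) : -1 ≤ t.re :=
  ht ▸ (abs_le.1 (Complex.abs_re_le_norm t)).1

theorem trace_re_nonneg {n : Type*} [Fintype n] {M : Matrix n n ℂ} (hM : M.PosSemidef) :
    0 ≤ M.trace.re := (Complex.nonneg_iff.1 hM.trace_nonneg).1

theorem eq_zero_of_trace_re_eq_zero {n : Type*} [Fintype n] {M : Matrix n n ℂ}
    (hM : M.PosSemidef) (h : M.trace.re = 0) : M = 0 := by
  classical
  exact hM.trace_eq_zero_iff.1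
    (Complex.ext h (Complex.nonneg_iff.1 hM.trace_nonneg).2.symm)

/-- The correlations of the bilocality scenario after both outer parties have been decomposed into
qubit blocks: in block `k` the first party measures `planeObs 1` and `planeObs (t k)`, in block `l`
the other one measures `planeObs 1` and `planeObs (r l)`. The operators `ω b k l` are the
unnormalised states of the pair of blocks `(k, l)` conditioned on the central outcome `b`; the sum
over `b` is a product state. -/
structure IsBlockModel {K L : Type*} [Fintype K] [Fintype L] (δ : ℝ) (t : K → ℂ) (r : L → ℂ)
    (ω : Fin 2 × Fin 2 → K → L → Matrix (Fin 2 × Fin 2) (Fin 2 × Fin 2) ℂ)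
    (R : K → Matrix (Fin 2) (Fin 2) ℂ) (S : L → Matrix (Fin 2) (Fin 2) ℂ) : Prop where
  norm_left : ∀ k, ‖t k‖ = 1
  norm_right : ∀ l, ‖r l‖ = 1
  posSemidef : ∀ b k l, (ω b k l).PosSemidef
  posSemidef_left : ∀ k, (R k).PosSemidef
  posSemidef_right : ∀ l, (S l).PosSemidef
  sum_eq : ∀ k l, ∑ b, ω b k l = R k ⊗ₖ S l
  trace_left : ∑ k, (R k).trace.re = 1
  trace_right : ∑ l, (S l).trace.re = 1
  prob_pos : ∀ b, 0 < ∑ k, ∑ l, (ω b k l).trace.re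
  corr00 : ∀ b, ∑ k, ∑ l, planeCorr (ω b k l) 1 1 = 0
  corr01 : ∀ b, ∑ k, ∑ l, planeCorr (ω b k l) 1 (r l) =
    (-1) ^ (b.1 : ℕ) * Real.cos δ * ∑ k, ∑ l, (ω b k l).trace.re
  corr10 : ∀ b, ∑ k, ∑ l, planeCorr (ω b k l) (t k) 1 =
    (-1) ^ (b.2 : ℕ) * Real.cos δ * ∑ k, ∑ l, (ω b k l).trace.re
  corr11 : ∀ b, ∑ k, ∑ l, planeCorr (ω b k l) (t k) (r l) =
    (if b.1 = b.2 then (-1) ^ (b.1 : ℕ) * Real.sin (2 * δ) else 0) *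
      ∑ k, ∑ l, (ω b k l).trace.re

namespace IsBlockModel

variable {K L : Type*} [Fintype K] [Fintype L] {δ : ℝ} {t : K → ℂ} {r : L → ℂ}
  {ω : Fin 2 × Fin 2 → K → L → Matrix (Fin 2 × Fin 2) (Fin 2 × Fin 2) ℂ}
  {R : K → Matrix (Fin 2) (Fin 2) ℂ} {S : L → Matrix (Fin 2) (Fin 2) ℂ}

/-- The outcomes `(0, 0)` and `(1, 1)` saturate a quantum bound and therefore occur only in blocks
in which both parties measure at the ideal angle. -/
theorem re_eq_sin_of_diagonal_outcome (h : IsBlockModel δ t r ω R S) (hδ0 : Real.sin δ ≠ 0)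
    (hc : 0 < Real.cos δ) (hC : 0 < Real.cos (2 * δ)) (b : Fin 2) (k : K) (l : L)
    (hω : ω (b, b) k l ≠ 0) : (t k).re = Real.sin δ ∧ (r l).re = Real.sin δ := by
  have hq : (ω (b, b) k l).trace.re ≠ 0 := fun h0 =>
    hω (eq_zero_of_trace_re_eq_zero (h.posSemidef _ _ _) h0)
  set s := Real.sin δ with hs
  set c := Real.cos δ with hcdef
  set C := Real.cos (2 * δ) with hCdef
  set ε : ℝ := (-1) ^ (b : ℕ) with hεdef
  have hε : ε ^ 2 = 1 := by rw [hεdef, ← pow_mul, mul_comm, pow_mul]; simp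
  have toProd : ∀ F : K → L → ℝ, ∑ i : K × L, F i.1 i.2 = ∑ k, ∑ l, F k l := fun F =>
    Fintype.sum_prod_type _
  have c00 := h.corr00 (b, b)
  have c01 := h.corr01 (b, b)
  have c10 := h.corr10 (b, b)
  have c11 := h.corr11 (b, b)
  rw [← toProd fun k l => planeCorr (ω (b, b) k l) 1 1] at c00
  rw [← toProd fun k l => planeCorr (ω (b, b) k l) 1 (r l)] at c01
  rw [← toProd fun k l => planeCorr (ω (b, b) k l) (t k) 1] at c10
  rw [← toProd fun k l => planeCorr (ω (b, b) k l) (t k) (r l), if_pos rfl] at c11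
  rw [← toProd fun k l => (ω (b, b) k l).trace.re] at c01 c10 c11
  have amgm : ∀ x y q : ℝ, 0 ≤ q → 2 * (x * y * q) ≤ (x ^ 2 + y ^ 2) * q := fun x y q hq => by
    nlinarith [mul_nonneg (sq_nonneg (x - y)) hq]
  constructor
  · refine eq_sin_of_saturation (ι := K × L) (ε := ε) (q := fun i => (ω (b, b) i.1 i.2).trace.re)
      (e := fun i => planeCorr (ω (b, b) i.1 i.2) 1 1)
      (f := fun i => planeCorr (ω (b, b) i.1 i.2) 1 (r i.2))
      (g := fun i => planeCorr (ω (b, b) i.1 i.2) (t i.1) 1)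
      (h := fun i => planeCorr (ω (b, b) i.1 i.2) (t i.1) (r i.2))
      (x := fun i => ‖((-s : ℝ) * 1 + (1 : ℝ) * t i.1 : ℂ)‖) (τ := fun i => (t i.1).re)
      hδ0 hC hε (fun i => trace_re_nonneg (h.posSemidef _ _ _)) (fun i => ?_) (fun i => ?_)
      (fun i => ?_) hc rfl c00 c01 c10 c11 (k, l) hq
    · rw [norm_sq_real_add_real_mul (h.norm_left _)]
      ring
    · have := sign_mul_planeCorr_le (h.posSemidef (b, b) i.1 i.2) hε
        ((-s : ℝ) * 1 + (1 : ℝ) * t i.1) ((1 : ℝ) * 1 + (0 : ℝ) * 1)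
      rw [planeCorr_affine] at this
      norm_num at this ⊢
      linarith
    · have h0 := trace_re_nonneg (h.posSemidef (b, b) i.1 i.2)
      have := sign_mul_planeCorr_le (h.posSemidef (b, b) i.1 i.2) hε
        ((C : ℝ) * 1 + (s : ℝ) * t i.1) ((0 : ℝ) * 1 + (c : ℝ) * r i.2)
      have h2 := amgm ‖(C * 1 + s * t i.1 : ℂ)‖ ‖((0 : ℝ) * 1 + c * r i.2 : ℂ)‖ _ h0
      rw [norm_sq_real_add_real_mul (h.norm_left _), norm_sq_real_add_real_mul (h.norm_right _)]
        at h2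
      rw [planeCorr_affine] at this
      linarith
  · refine eq_sin_of_saturation (ι := K × L) (ε := ε) (q := fun i => (ω (b, b) i.1 i.2).trace.re)
      (e := fun i => planeCorr (ω (b, b) i.1 i.2) 1 1)
      (g := fun i => planeCorr (ω (b, b) i.1 i.2) 1 (r i.2))
      (f := fun i => planeCorr (ω (b, b) i.1 i.2) (t i.1) 1)
      (h := fun i => planeCorr (ω (b, b) i.1 i.2) (t i.1) (r i.2))
      (x := fun i => ‖((-s : ℝ) * 1 + (1 : ℝ) * r i.2 : ℂ)‖) (τ := fun i => (r i.2).re)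
      hδ0 hC hε (fun i => trace_re_nonneg (h.posSemidef _ _ _)) (fun i => ?_) (fun i => ?_)
      (fun i => ?_) hc rfl c00 c10 c01 c11 (k, l) hq
    · rw [norm_sq_real_add_real_mul (h.norm_right _)]
      ring
    · have := sign_mul_planeCorr_le (h.posSemidef (b, b) i.1 i.2) hε
        ((1 : ℝ) * 1 + (0 : ℝ) * 1) ((-s : ℝ) * 1 + (1 : ℝ) * r i.2)
      rw [planeCorr_affine] at this
      norm_num at this ⊢
      linarith
    · have h0 := trace_re_nonneg (h.posSemidef (b, b) i.1 i.2)
      have := sign_mul_planeCorr_le (h.posSemidef (b, b) i.1 i.2) hε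
        ((0 : ℝ) * 1 + (c : ℝ) * t i.1) ((C : ℝ) * 1 + (s : ℝ) * r i.2)
      have h2 := amgm ‖((0 : ℝ) * 1 + c * t i.1 : ℂ)‖ ‖(C * 1 + s * r i.2 : ℂ)‖ _ h0
      rw [norm_sq_real_add_real_mul (h.norm_left _), norm_sq_real_add_real_mul (h.norm_right _)]
        at h2
      rw [planeCorr_affine] at this
      linarith

/-- The total excess over the value `1` of a witness
`α A₋ ⊗ C₊ + β A₊ ⊗ C₋`, where `A₋`, `A₊`, `C₊`, `C₋` are the normalised differences and sums of the
two observables of each party, is nonnegative, because the outcomes `(0, 1)` and `(1, 0)` attain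
the values `1` and `-1`. -/
theorem witness_excess_nonneg (h : IsBlockModel δ t r ω R S) (hδ0 : Real.sin δ ≠ 0)
    (hc : 0 < Real.cos δ) (hC : 0 < Real.cos (2 * δ)) {m n : ℝ} (hm : 0 < m) (hn : 0 < n)
    (hm2 : m ^ 2 = (1 - Real.sin δ) / 2) (hn2 : n ^ 2 = (1 + Real.sin δ) / 2)
    {a b : K → ℝ} (ha : ∀ k, 0 ≤ a k) (hb : ∀ k, 0 ≤ b k) (ha2 : ∀ k, a k ^ 2 = (1 - (t k).re) / 2)
    (hb2 : ∀ k, b k ^ 2 = (1 + (t k).re) / 2)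
    {x y : L → ℝ} (hx : ∀ l, 0 ≤ x l) (hy : ∀ l, 0 ≤ y l) (hx2 : ∀ l, x l ^ 2 = (1 + (r l).re) / 2)
    (hy2 : ∀ l, y l ^ 2 = (1 - (r l).re) / 2) {α β : ℝ} (hα : 0 ≤ α) (hβ : 0 ≤ β)
    (hαβ : α + β = 1) :
    0 ≤ ∑ k, ∑ l, (R k).trace.re * (S l).trace.re *
      (if (t k).re = Real.sin δ ∧ (r l).re = Real.sin δ then 0 else
        max (α * (a k * x l)) (β * (b k * y l)) / (m * n) - 1) := by
  have hcs : Real.sin δ ^ 2 + Real.cos δ ^ 2 = 1 := Real.sin_sq_add_cos_sq δ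
  have hmn : 2 * (m * n) = Real.cos δ := by
    refine (sq_eq_sq₀ (by positivity) hc.le).1 ?_
    rw [mul_pow, mul_pow, hm2, hn2]
    linarith
  -- `μ` and `ν` normalise the difference and the sum of the two ideal observables
  set μ := 1 / (2 * m) with hμ
  set ν := 1 / (2 * n) with hν
  have hμ0 : 0 < μ := by positivity
  have hν0 : 0 < ν := by positivity
  have hμν : μ * ν * (2 * Real.cos δ) = 1 := by
    rw [hμ, hν, ← hmn]
    field_simp
  let w₁ : K → ℂ := fun k => μ * 1 + (-μ : ℝ) * t k
  let w₂ : K → ℂ := fun k => ν * 1 + ν * t k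
  let w₁' : L → ℂ := fun l => ν * 1 + ν * r l
  let w₂' : L → ℂ := fun l => (-μ : ℝ) * 1 + μ * r l
  have sq_norm_eq : ∀ {u v q : ℝ} {w : ℂ}, 0 ≤ u → 0 < v → ‖w‖ ^ 2 = (1 / (2 * v)) ^ 2 * (2 * q) →
      u ^ 2 = q / 2 → ‖w‖ = u / v := fun {u v q w} hu hv h1 h2 => by
    refine (sq_eq_sq₀ (norm_nonneg _) (by positivity)).1 ?_
    rw [h1, div_pow u, h2]
    field_simp
  have n₁ : ∀ k, ‖w₁ k‖ = a k / m := fun k => sq_norm_eq (ha k) hm (by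
    rw [norm_sq_real_add_real_mul (h.norm_left k)]; ring) (ha2 k)
  have n₂ : ∀ k, ‖w₂ k‖ = b k / n := fun k => sq_norm_eq (hb k) hn (by
    rw [norm_sq_real_add_real_mul (h.norm_left k)]; ring) (hb2 k)
  have n₁' : ∀ l, ‖w₁' l‖ = x l / n := fun l => sq_norm_eq (hx l) hn (by
    rw [norm_sq_real_add_real_mul (h.norm_right l)]; ring) (hx2 l)
  have n₂' : ∀ l, ‖w₂' l‖ = y l / m := fun l => sq_norm_eq (hy l) hm (by
    rw [norm_sq_real_add_real_mul (h.norm_right l)]; ring) (hy2 l)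
  have unit_sq : ∀ {v : ℂ}, ‖v‖ = 1 → v.re * v.re + v.im * v.im = 1 := fun {v} hv => by
    rw [← Complex.normSq_apply, ← Complex.sq_norm, hv, one_pow]
  have o : ∀ k, (w₁ k * star (w₂ k)).re = 0 := fun k => by
    simp only [w₁, w₂, Complex.star_def, Complex.mul_re, Complex.conj_re, Complex.conj_im,
      Complex.add_re, Complex.add_im, Complex.ofReal_re, Complex.ofReal_im, Complex.mul_im,
      Complex.one_re, Complex.one_im]
    linear_combination (-μ * ν) * unit_sq (h.norm_left k)
  have o' : ∀ l, (w₁' l * star (w₂' l)).re = 0 := fun l => by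
    simp only [w₁', w₂', Complex.star_def, Complex.mul_re, Complex.conj_re, Complex.conj_im,
      Complex.add_re, Complex.add_im, Complex.ofReal_re, Complex.ofReal_im, Complex.mul_im,
      Complex.one_re, Complex.one_im]
    linear_combination (μ * ν) * unit_sq (h.norm_right l)
  -- the total values of the two terms of the witness
  have total : ∀ b : Fin 2 × Fin 2, ∀ u v u' v' : ℝ,
      ∑ k, ∑ l, planeCorr (ω b k l) (u * 1 + v * t k) (u' * 1 + v' * r l) =
        u * v' * ((-1) ^ (b.1 : ℕ) * Real.cos δ * ∑ k, ∑ l, (ω b k l).trace.re)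
        + v * u' * ((-1) ^ (b.2 : ℕ) * Real.cos δ * ∑ k, ∑ l, (ω b k l).trace.re)
        + v * v' * ((if b.1 = b.2 then (-1) ^ (b.1 : ℕ) * Real.sin (2 * δ) else 0) *
            ∑ k, ∑ l, (ω b k l).trace.re) := fun b u v u' v' => by
    rw [← h.corr01, ← h.corr10, ← h.corr11]
    simp only [planeCorr_affine, Finset.sum_add_distrib, ← Finset.mul_sum]
    rw [h.corr00]
    ring
  set p₁ := ∑ k, ∑ l, (ω (0, 1) k l).trace.re with hp₁
  set p₂ := ∑ k, ∑ l, (ω (1, 0) k l).trace.re with hp₂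
  have t₁ : ∑ k, ∑ l, planeCorr (ω (0, 1) k l) (w₁ k) (w₁' l) = p₁ := by
    rw [total]
    simp
    linear_combination p₁ * hμν
  have t₂ : ∑ k, ∑ l, planeCorr (ω (0, 1) k l) (w₂ k) (w₂' l) = p₁ := by
    rw [total]
    simp
    linear_combination p₁ * hμν
  have t₃ : ∑ k, ∑ l, planeCorr (ω (1, 0) k l) (w₁ k) (w₁' l) = -p₂ := by
    rw [total]
    simp
    linear_combination (-p₂) * hμν
  have t₄ : ∑ k, ∑ l, planeCorr (ω (1, 0) k l) (w₂ k) (w₂' l) = -p₂ := by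
    rw [total]
    simp
    linear_combination (-p₂) * hμν
  have zero_sum : ∑ k, ∑ l,
      (α * (planeCorr (ω (0, 1) k l) (w₁ k) (w₁' l) - planeCorr (ω (1, 0) k l) (w₁ k) (w₁' l))
        + β * (planeCorr (ω (0, 1) k l) (w₂ k) (w₂' l) - planeCorr (ω (1, 0) k l) (w₂ k) (w₂' l))
        - ((ω (0, 1) k l).trace.re + (ω (1, 0) k l).trace.re)) = 0 := by
    simp only [Finset.sum_sub_distrib, Finset.sum_add_distrib, ← Finset.mul_sum, t₁, t₂, t₃, t₄,
      ← hp₁, ← hp₂]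
    linear_combination (p₁ + p₂) * hαβ
  refine zero_sum.symm.le.trans <| Finset.sum_le_sum fun k _ => Finset.sum_le_sum fun l _ => ?_
  have P₁ := h.posSemidef (0, 1) k l
  have P₂ := h.posSemidef (1, 0) k l
  split_ifs with hkl
  · have e₁ : a k = m := (sq_eq_sq₀ (ha k) hm.le).1 (by rw [ha2, hm2, hkl.1])
    have e₂ : b k = n := (sq_eq_sq₀ (hb k) hn.le).1 (by rw [hb2, hn2, hkl.1])
    have e₃ : x l = n := (sq_eq_sq₀ (hx l) hn.le).1 (by rw [hx2, hn2, hkl.2])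
    have e₄ : y l = m := (sq_eq_sq₀ (hy l) hm.le).1 (by rw [hy2, hm2, hkl.2])
    have b₁ := planeCorr_le P₁ (w₁ k) (w₁' l)
    have b₂ := planeCorr_le P₁ (w₂ k) (w₂' l)
    have b₃ := neg_planeCorr_le P₂ (w₁ k) (w₁' l)
    have b₄ := neg_planeCorr_le P₂ (w₂ k) (w₂' l)
    rw [n₁, n₁', e₁, e₃, div_self hm.ne', div_self hn.ne', one_mul, one_mul] at b₁ b₃
    rw [n₂, n₂', e₂, e₄, div_self hm.ne', div_self hn.ne', one_mul, one_mul] at b₂ b₄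
    rw [mul_zero]
    have c₁ := mul_le_mul_of_nonneg_left (add_le_add b₁ b₃) hα
    have c₂ := mul_le_mul_of_nonneg_left (add_le_add b₂ b₄) hβ
    have : α * ((ω (0, 1) k l).trace.re + (ω (1, 0) k l).trace.re)
      + β * ((ω (0, 1) k l).trace.re + (ω (1, 0) k l).trace.re)
      = (ω (0, 1) k l).trace.re + (ω (1, 0) k l).trace.re := by rw [← add_mul, hαβ, one_mul]
    linarith
  · -- outside the ideal blocks only the outcomes `(0, 1)` and `(1, 0)` occur
    have z₀ : ω (0, 0) k l = 0 := by
      by_contra h0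
      exact hkl (h.re_eq_sin_of_diagonal_outcome hδ0 hc hC 0 k l h0)
    have z₁ : ω (1, 1) k l = 0 := by
      by_contra h0
      exact hkl (h.re_eq_sin_of_diagonal_outcome hδ0 hc hC 1 k l h0)
    have hsum : ω (0, 1) k l + ω (1, 0) k l = R k ⊗ₖ S l := by
      have := h.sum_eq k l
      simpa [Fintype.sum_prod_type, z₀, z₁] using this
    have bound := planeCorr_sub_le_of_add_eq_kronecker P₁ P₂ (h.posSemidef_left k)
      (h.posSemidef_right l) hsum hα hβ (o k) (o' l)
    have htr : (ω (0, 1) k l).trace.re + (ω (1, 0) k l).trace.re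
        = (R k).trace.re * (S l).trace.re := by
      rw [← Complex.add_re, ← Matrix.trace_add, hsum, Matrix.trace_kronecker, Complex.mul_re,
        ← (Complex.nonneg_iff.1 (h.posSemidef_left k).trace_nonneg).2]
      ring
    rw [n₁, n₂, n₁', n₂'] at bound
    have hmax : max (α * (a k / m * (x l / n))) (β * (b k / n * (y l / m)))
        = max (α * (a k * x l)) (β * (b k * y l)) / (m * n) := by
      rw [← max_div_div_right (by positivity)]
      congr 1 <;> field_simp
    rw [hmax] at bound
    rw [htr]
    linarith

/-- Both parties measure at the ideal angle in every block that has nonzero weight. The bound on `δ`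
is used to make both half-angle coordinates `√((1 ± sin δ) / 2)` at least `1 / 2`. -/
theorem re_eq_sin (h : IsBlockModel δ t r ω R S) (hδ0 : δ ≠ 0) (hδ : |δ| ≤ Real.pi / 6) :
    (∀ k, (t k).re ≠ Real.sin δ → R k = 0) ∧ ∀ l, (r l).re ≠ Real.sin δ → S l = 0 := by
  have hπ := Real.pi_pos
  obtain ⟨hδ1, hδ2⟩ := abs_le.1 hδ
  have hs0 : Real.sin δ ≠ 0 := fun h0 =>
    hδ0 ((Real.sin_eq_zero_iff_of_lt_of_lt (by linarith) (by linarith)).1 h0)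
  have hc : 0 < Real.cos δ := Real.cos_pos_of_mem_Ioo ⟨by linarith, by linarith⟩
  have hC : 0 < Real.cos (2 * δ) := Real.cos_pos_of_mem_Ioo ⟨by linarith, by linarith⟩
  have hs1 : Real.sin δ ≤ 1 / 2 := by
    rw [← Real.sin_pi_div_six]
    exact Real.sin_le_sin_of_le_of_le_pi_div_two (by linarith) (by linarith) hδ2
  have hs2 : -(1 / 2) ≤ Real.sin δ := by
    rw [← Real.sin_pi_div_six, ← Real.sin_neg]
    exact Real.sin_le_sin_of_le_of_le_pi_div_two (by linarith) (by linarith) hδ1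
  have half : ∀ {q : ℝ}, 1 / 2 ≤ q → 1 / 2 ≤ √(q / 2) := fun {q} hq => by
    apply Real.le_sqrt_of_sq_le
    linarith
  have hsq : ∀ {q : ℝ}, 0 ≤ q → √(q / 2) ^ 2 = q / 2 := fun {q} hq =>
    Real.sq_sqrt (by linarith)
  set m := √((1 - Real.sin δ) / 2) with hmdef
  set n := √((1 + Real.sin δ) / 2) with hndef
  have hm : 1 / 2 ≤ m := half (by linarith)
  have hn : 1 / 2 ≤ n := half (by linarith)
  have hm2 : m ^ 2 = (1 - Real.sin δ) / 2 := hsq (by linarith)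
  have hn2 : n ^ 2 = (1 + Real.sin δ) / 2 := hsq (by linarith)
  have ha2 : ∀ k, √((1 - (t k).re) / 2) ^ 2 = (1 - (t k).re) / 2 := fun k =>
    hsq (by linarith [re_le_one_of_norm_eq_one (h.norm_left k)])
  have hb2 : ∀ k, √((1 + (t k).re) / 2) ^ 2 = (1 + (t k).re) / 2 := fun k =>
    hsq (by linarith [neg_one_le_re_of_norm_eq_one (h.norm_left k)])
  have hx2 : ∀ l, √((1 + (r l).re) / 2) ^ 2 = (1 + (r l).re) / 2 := fun l =>
    hsq (by linarith [neg_one_le_re_of_norm_eq_one (h.norm_right l)])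
  have hy2 : ∀ l, √((1 - (r l).re) / 2) ^ 2 = (1 - (r l).re) / 2 := fun l =>
    hsq (by linarith [re_le_one_of_norm_eq_one (h.norm_right l)])
  have excess := fun α β (hα : (0 : ℝ) ≤ α) (hβ : 0 ≤ β) (hαβ : α + β = 1) =>
    h.witness_excess_nonneg hs0 hc hC (by linarith) (by linarith) hm2 hn2
      (fun _ => Real.sqrt_nonneg _) (fun _ => Real.sqrt_nonneg _) ha2 hb2
      (fun _ => Real.sqrt_nonneg _) (fun _ => Real.sqrt_nonneg _) hx2 hy2 hα hβ hαβ
  -- a block in which the outcome `(0, 0)` occurs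
  obtain ⟨k₀, l₀, hω⟩ : ∃ k l, ω (0, 0) k l ≠ 0 := by
    by_contra! h0
    have := h.prob_pos (0, 0)
    simp [h0] at this
  have hideal := h.re_eq_sin_of_diagonal_outcome hs0 hc hC 0 k₀ l₀ hω
  have hRS : R k₀ ⊗ₖ S l₀ ≠ 0 := fun h0 => hω <| by
    refine eq_zero_of_trace_re_eq_zero (h.posSemidef _ _ _)
      (le_antisymm ?_ (trace_re_nonneg (h.posSemidef _ _ _)))
    have e := congrArg (fun M => M.trace.re) (h.sum_eq k₀ l₀)
    simp only [h0, Matrix.trace_sum, Complex.re_sum, Matrix.trace_zero, Complex.zero_re] at e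
    rw [← e]
    exact Finset.single_le_sum (f := fun b => (ω b k₀ l₀).trace.re)
      (fun b _ => trace_re_nonneg (h.posSemidef b k₀ l₀)) (Finset.mem_univ _)
  have pos : ∀ {M : Matrix (Fin 2) (Fin 2) ℂ}, M.PosSemidef → M ≠ 0 → 0 < M.trace.re :=
    fun hM h0 => lt_of_le_of_ne (trace_re_nonneg hM)
      fun h1 => h0 (eq_zero_of_trace_re_eq_zero hM h1.symm)
  have hR₀ : 0 < (R k₀).trace.re := pos (h.posSemidef_left _) fun h0 => hRS (by simp [h0])
  have hS₀ : 0 < (S l₀).trace.re := pos (h.posSemidef_right _) fun h0 => hRS (by simp [h0])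
  have hR : ∀ k, 0 ≤ (R k).trace.re := fun k => trace_re_nonneg (h.posSemidef_left k)
  have hS : ∀ l, 0 ≤ (S l).trace.re := fun l => trace_re_nonneg (h.posSemidef_right l)
  classical
  constructor
  · intro k hk
    refine eq_zero_of_trace_re_eq_zero (h.posSemidef_left k) ?_
    refine weights_eq_zero_of_witness hn hm (by linarith) (fun l => (S l).trace.re)
      (fun l => √((1 + (r l).re) / 2)) (fun l => √((1 - (r l).re) / 2)) hS
      (fun _ => Real.sqrt_nonneg _) (fun _ => Real.sqrt_nonneg _)
      (fun l => by rw [hx2, hy2]; ring) (fun l => (r l).re = Real.sin δ)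
      (fun l hl => by rw [hl]; exact ⟨rfl, rfl⟩) ⟨l₀, hideal.2, hS₀⟩
      (fun k => (R k).trace.re) (fun k => √((1 - (t k).re) / 2)) (fun k => √((1 + (t k).re) / 2))
      hR h.trace_left (fun _ => Real.sqrt_nonneg _) (fun _ => Real.sqrt_nonneg _)
      (fun k => by rw [ha2, hb2]; ring) (fun k => (t k).re = Real.sin δ)
      (fun k hk => by rw [hk]; exact ⟨rfl, rfl⟩) (fun α β hα hβ hαβ => ?_) k hk
    have := excess α β hα hβ hαβ
    rw [Finset.sum_comm] at this
    refine this.trans_eq (Finset.sum_congr rfl fun l _ => Finset.sum_congr rfl fun k _ => ?_)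
    rw [mul_comm (R k).trace.re, mul_comm n m, mul_comm √((1 - (t k).re) / 2),
      mul_comm √((1 + (t k).re) / 2)]
    simp only [and_comm]
  · intro l hl
    refine eq_zero_of_trace_re_eq_zero (h.posSemidef_right l) ?_
    exact weights_eq_zero_of_witness hm hn (by linarith) (fun k => (R k).trace.re)
      (fun k => √((1 - (t k).re) / 2)) (fun k => √((1 + (t k).re) / 2))
      hR (fun _ => Real.sqrt_nonneg _) (fun _ => Real.sqrt_nonneg _)
      (fun k => by rw [ha2, hb2]; ring) (fun k => (t k).re = Real.sin δ)
      (fun k hk => by rw [hk]; exact ⟨rfl, rfl⟩) ⟨k₀, hideal.1, hR₀⟩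
      (fun l => (S l).trace.re) (fun l => √((1 + (r l).re) / 2)) (fun l => √((1 - (r l).re) / 2)) hS
      h.trace_right
      (fun _ => Real.sqrt_nonneg _) (fun _ => Real.sqrt_nonneg _)
      (fun l => by rw [hx2, hy2]; ring) (fun l => (r l).re = Real.sin δ)
      (fun l hl => by rw [hl]; exact ⟨rfl, rfl⟩) excess l hl

end IsBlockModel

/-! ### Jordan's lemma for two dichotomic measurements -/

theorem exists_diagonalization {n : Type*} [Fintype n] [DecidableEq n] {M : Matrix n n ℂ}
    (hM : M.IsHermitian) : ∃ (U : Matrix n n ℂ) (d : n → ℝ),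
      Uᴴ * U = 1 ∧ U * Uᴴ = 1 ∧ M = U * diagonal (fun i => (d i : ℂ)) * Uᴴ := by
  refine ⟨hM.eigenvectorUnitary, hM.eigenvalues, ?_, ?_, ?_⟩
  · exact (Matrix.mem_unitaryGroup_iff'.1 hM.eigenvectorUnitary.2)
  · exact (Matrix.mem_unitaryGroup_iff.1 hM.eigenvectorUnitary.2)
  · have := hM.spectral_theorem
    rw [Unitary.conjStarAlgAut_apply] at this
    exact this

/-- Every unitary matrix is diagonalised by a unitary. The Cayley transform
`G = i (ξ + T) (ξ - T)⁻¹` at a point `ξ` of the circle outside the spectrum is Hermitian and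
has the same eigenvectors. -/
theorem exists_diagonalization_of_unitary {n : Type*} [Fintype n] [DecidableEq n]
    {T : Matrix n n ℂ} (hT : Tᴴ * T = 1) : ∃ (U : Matrix n n ℂ) (μ : n → ℂ),
      Uᴴ * U = 1 ∧ U * Uᴴ = 1 ∧ (∀ i, ‖μ i‖ = 1) ∧ T = U * diagonal μ * Uᴴ := by
  have hT' : T * Tᴴ = 1 := mul_eq_one_comm.1 hT
  obtain ⟨ξ, hξ, hdet⟩ : ∃ ξ : ℂ, ‖ξ‖ = 1 ∧ (T.charpoly.eval ξ) ≠ 0 := by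
    have hinf : (Set.range fun x : ℝ => ((x : ℂ) - Complex.I) / (x + Complex.I)).Infinite := by
      apply Set.infinite_range_of_injective
      intro x y hxy
      have hx : (x : ℂ) + Complex.I ≠ 0 := fun h => by simpa using congrArg Complex.im h
      have hy : (y : ℂ) + Complex.I ≠ 0 := fun h => by simpa using congrArg Complex.im h
      simp only at hxy
      rw [div_eq_div_iff hx hy] at hxy
      have := congrArg Complex.im hxy
      simp at this
      linarith
    obtain ⟨ξ, ⟨x, hx⟩, h⟩ := hinf.exists_notMem_finset T.charpoly.roots.toFinset
    refine ⟨ξ, ?_, fun h0 => h ?_⟩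
    · have hx0 : (x : ℂ) + Complex.I ≠ 0 := fun h => by simpa using congrArg Complex.im h
      have : (x : ℂ) - Complex.I = star ((x : ℂ) + Complex.I) := by simp [sub_eq_add_neg]
      simp only at hx
      rw [← hx, this, norm_div, norm_star, div_self (norm_ne_zero_iff.2 hx0)]
    · rw [Multiset.mem_toFinset, Polynomial.mem_roots T.charpoly_monic.ne_zero]
      exact h0
  rw [Matrix.eval_charpoly, Matrix.scalar_apply, ← smul_one_eq_diagonal] at hdet
  set E : Matrix n n ℂ := ξ • (1 : Matrix n n ℂ) - T with hE
  have hu : IsUnit E.det := isUnit_iff_ne_zero.2 hdet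
  have hEW : E * E⁻¹ = 1 := Matrix.mul_nonsing_inv _ hu
  have hWE : E⁻¹ * E = 1 := Matrix.nonsing_inv_mul _ hu
  have hξξ : star ξ * ξ = 1 := by
    rw [Complex.star_def, ← Complex.normSq_eq_conj_mul_self, Complex.normSq_eq_norm_sq, hξ]; simp
  set G : Matrix n n ℂ := Complex.I • ((ξ • (1 : Matrix n n ℂ) + T) * E⁻¹) with hG
  have hGE : G * E = Complex.I • (ξ • (1 : Matrix n n ℂ) + T) := by
    rw [hG, smul_mul_assoc, mul_assoc, hWE, mul_one]
  have hGh : G.IsHermitian := by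
    have key : Eᴴ * G * E = Eᴴ * Gᴴ * E := by
      rw [← conjTranspose_mul, mul_assoc, hGE, hE]
      simp only [conjTranspose_smul, conjTranspose_add, conjTranspose_sub, conjTranspose_one,
        smul_mul_assoc, mul_smul_comm, sub_mul, mul_add, add_mul, mul_sub, one_mul, mul_one, hT,
        smul_add, smul_sub, smul_smul, Complex.star_def, Complex.conj_I]
      have e1 : Complex.I * ξ * (starRingEnd ℂ) ξ = Complex.I := by
        rw [mul_assoc, mul_comm ξ, ← Complex.star_def, hξξ, mul_one]
      have e2 : (starRingEnd ℂ) (Complex.I * ξ) = -(Complex.I * (starRingEnd ℂ) ξ) := by simp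
      have e3 : ξ * (starRingEnd ℂ) (Complex.I * ξ) = -Complex.I := by
        rw [e2, mul_neg, mul_left_comm, ← mul_assoc, e1]
      rw [e1, e3, e2]
      module
    have hEh : (Eᴴ)⁻¹ * Eᴴ = 1 := by
      rw [← conjTranspose_nonsing_inv, ← conjTranspose_mul, hEW, conjTranspose_one]
    have e : ∀ M : Matrix n n ℂ, M = (Eᴴ)⁻¹ * (Eᴴ * M * E) * E⁻¹ := fun M => by
      rw [mul_assoc, mul_assoc, mul_assoc, hEW, mul_one, ← mul_assoc, hEh, one_mul]
    have h := e Gᴴ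
    rw [← key, ← e G] at h
    exact h
  obtain ⟨U, g, hU1, hU2, hGU⟩ := exists_diagonalization hGh
  have hgi : ∀ i, ((g i : ℂ) + Complex.I) ≠ 0 := fun i h => by simpa using congrArg Complex.im h
  refine ⟨U, fun i => ξ * ((g i : ℂ) - Complex.I) / ((g i : ℂ) + Complex.I), hU1, hU2, fun i => ?_,
    ?_⟩
  · have : (g i : ℂ) - Complex.I = star ((g i : ℂ) + Complex.I) := by simp [sub_eq_add_neg]
    simp only
    rw [this, norm_div, norm_mul, norm_star, hξ, one_mul, div_self (norm_ne_zero_iff.2 (hgi i))]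
  · -- `(G + i) T = ξ (G - i)`, row by row in the eigenbasis of `G`
    have h1 : Uᴴ * T = diagonal (fun i => ξ * ((g i : ℂ) - Complex.I) / ((g i : ℂ) + Complex.I))
        * Uᴴ := by
      have h2 : Uᴴ * G = diagonal (fun i => (g i : ℂ)) * Uᴴ := by
        rw [hGU, ← mul_assoc, ← mul_assoc, hU1, one_mul]
      have h3 : diagonal (fun i => (g i : ℂ)) * Uᴴ * E
          = Complex.I • (ξ • Uᴴ + Uᴴ * T) := by
        rw [← h2, mul_assoc, hGE, mul_smul_comm, mul_add, mul_smul_comm, mul_one]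
      rw [hE, mul_sub, mul_smul_comm, mul_one, mul_assoc] at h3
      ext i j
      have h4 := congrFun (congrFun h3 i) j
      simp only [Matrix.sub_apply, Matrix.smul_apply, Matrix.add_apply, diagonal_mul,
        smul_eq_mul] at h4 ⊢
      have := hgi i
      field_simp
      linear_combination -h4
    rw [mul_assoc, ← h1, ← mul_assoc, hU2, one_mul]

/-- The observable `P 0 - P 1` of a two-outcome measurement has a Hermitian complement `D`, with
which it can be dilated to a Hermitian unitary `!![A, D; D, -A]`. -/
theorem exists_complement_of_isPOVM {n : Type*} [Fintype n] [DecidableEq n]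
    {P : Fin 2 → Matrix n n ℂ} (hP : IsPOVM P) :
    (P 0 - P 1).IsHermitian ∧ ∃ D : Matrix n n ℂ, D.IsHermitian ∧
      (P 0 - P 1) * (P 0 - P 1) + D * D = 1 ∧ (P 0 - P 1) * D = D * (P 0 - P 1) := by
  have hsum : P 0 + P 1 = 1 := by simpa using hP.sum_eq_one
  have h1 : P 1 = 1 - P 0 := eq_sub_of_add_eq' hsum
  obtain ⟨U, d, hU1, hU2, hd⟩ := exists_diagonalization (hP.posSemidef 0).1
  have conj_mul : ∀ f g : n → ℂ, (U * diagonal f * Uᴴ) * (U * diagonal g * Uᴴ)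
      = U * diagonal (fun i => f i * g i) * Uᴴ := fun f g => by
    rw [← diagonal_mul_diagonal]
    simp only [mul_assoc]
    rw [← mul_assoc Uᴴ U, hU1, one_mul]
  have conj_herm : ∀ f : n → ℝ, (U * diagonal (fun i => (f i : ℂ)) * Uᴴ).IsHermitian := fun f => by
    rw [IsHermitian, conjTranspose_mul, conjTranspose_mul, conjTranspose_conjTranspose,
      diagonal_conjTranspose, mul_assoc]
    congr
    ext i
    simp
  have conj_one : U * diagonal (fun _ => (1 : ℂ)) * Uᴴ = 1 := by
    rw [diagonal_one, mul_one, hU2]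
  have hd' : P 1 = U * diagonal (fun i => ((1 - d i : ℝ) : ℂ)) * Uᴴ := by
    rw [h1, hd, ← conj_one, ← sub_mul, ← mul_sub, diagonal_sub]
    congr
    ext i
    simp
  have hA : P 0 - P 1 = U * diagonal (fun i => ((2 * d i - 1 : ℝ) : ℂ)) * Uᴴ := by
    rw [hd', hd, ← sub_mul, ← mul_sub, diagonal_sub]
    congr
    ext i
    push_cast
    ring
  have nonneg : ∀ {M : Matrix n n ℂ} {f : n → ℝ}, M.PosSemidef →
      M = U * diagonal (fun i => (f i : ℂ)) * Uᴴ → ∀ i, 0 ≤ f i := fun {M f} hM h i => by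
    have := (hM.conjTranspose_mul_mul_same U).diag_nonneg (i := i)
    rw [h, mul_assoc, mul_assoc, hU1, mul_one, ← mul_assoc, hU1, one_mul, diagonal_apply_eq] at this
    exact_mod_cast this
  have h0 := nonneg (hP.posSemidef 0) hd
  have h1 := nonneg (hP.posSemidef 1) hd'
  refine ⟨(hP.posSemidef 0).1.sub (hP.posSemidef 1).1,
    U * diagonal (fun i => ((√(1 - (2 * d i - 1) ^ 2) : ℝ) : ℂ)) * Uᴴ, conj_herm _, ?_, ?_⟩
  · rw [hA, conj_mul, conj_mul, ← add_mul, ← mul_add, diagonal_add, ← conj_one]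
    congr
    ext i
    have : √(1 - (2 * d i - 1) ^ 2) * √(1 - (2 * d i - 1) ^ 2) = 1 - (2 * d i - 1) ^ 2 :=
      Real.mul_self_sqrt (by nlinarith [mul_nonneg (h0 i) (h1 i)])
    rw [← Complex.ofReal_mul, ← Complex.ofReal_mul, this, ← Complex.ofReal_add]
    norm_num
    ring
  · rw [hA, conj_mul, conj_mul]
    simp only [mul_comm]

theorem inv_sqrt_two_mul_self : ((√2 : ℝ) : ℂ)⁻¹ * ((√2 : ℝ) : ℂ)⁻¹ = 1 / 2 := by
  rw [← mul_inv, ← Complex.ofReal_mul, Real.mul_self_sqrt (by norm_num)]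
  norm_num

/-- The qubit block of two reflections `X` and `Y` that belongs to a basis vector `i` in which
`Y * X` is diagonal with eigenvalue `μ i`, as an operator into the qubit. The levels are ordered so
that the phase of the second reflection lies in the upper half-plane. -/
noncomputable def reflectionBlock {n : Type*} [Fintype n] (U X : Matrix n n ℂ) (μ : n → ℂ) (i : n) :
    Matrix (Fin 2) n ℂ :=
  ((√2 : ℝ) : ℂ)⁻¹ • if 0 ≤ (μ i).im then of ![Uᴴ i, (Uᴴ * X) i] else of ![(Uᴴ * X) i, Uᴴ i]

/-- A version of Jordan's lemma: two reflections are a direct sum of pairs of qubit reflections, in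
the sense that they are mixtures of compressions of such pairs. -/
theorem exists_qubit_blocks_of_reflections {n : Type*} [Fintype n] [DecidableEq n]
    {X Y : Matrix n n ℂ} (hX : X.IsHermitian) (hY : Y.IsHermitian) (hX2 : X * X = 1)
    (hY2 : Y * Y = 1) : ∃ (N : n → Matrix (Fin 2) n ℂ) (t : n → ℂ),
      (∀ k, ‖t k‖ = 1) ∧ (∀ k, 0 ≤ (t k).im) ∧ ∑ k, (N k)ᴴ * N k = 1 ∧
      ∑ k, (N k)ᴴ * planeObs 1 * N k = X ∧ ∑ k, (N k)ᴴ * planeObs (t k) * N k = Y := by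
  obtain ⟨U, μ, hU1, hU2, hμ, hT⟩ := exists_diagonalization_of_unitary (T := Y * X) (by
    rw [conjTranspose_mul, hX.eq, hY.eq, mul_assoc, ← mul_assoc Y, hY2, one_mul, hX2])
  have herm : (Uᴴ * X)ᴴ = X * U := by rw [conjTranspose_mul, hX.eq, conjTranspose_conjTranspose]
  let t : n → ℂ := fun k => if 0 ≤ (μ k).im then μ k else star (μ k)
  -- the two orders of the levels give the same compressions
  have entry : ∀ (f : n → ℂ) (k i j : n),
      ((reflectionBlock U X μ k)ᴴ * planeObs (if 0 ≤ (μ k).im then f k else star (f k))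
        * reflectionBlock U X μ k) i j
      = 1 / 2 * (U i k * f k * (Uᴴ * X) k j + (X * U) i k * star (f k) * Uᴴ k j) :=
    fun f k i j => by
      have e := congrFun (congrFun herm i) k
      rw [conjTranspose_apply] at e
      rw [← inv_sqrt_two_mul_self, ← e]
      unfold reflectionBlock
      split_ifs <;>
      simp [Matrix.mul_apply, Fin.sum_univ_two, planeObs] <;> ring
  have total : ∀ f : n → ℂ, ∑ k, (reflectionBlock U X μ k)ᴴ *
      planeObs (if 0 ≤ (μ k).im then f k else star (f k)) * reflectionBlock U X μ k
      = (1 / 2 : ℂ) • (U * diagonal f * Uᴴ * X + X * (U * diagonal (star f) * Uᴴ)) :=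
    fun f => by
      ext i j
      rw [Matrix.sum_apply]
      simp only [entry]
      rw [← Finset.mul_sum, Finset.sum_add_distrib, Matrix.smul_apply, Matrix.add_apply,
        mul_assoc (U * diagonal f), ← mul_assoc X, ← mul_assoc X,
        Matrix.mul_apply (M := U * diagonal f), Matrix.mul_apply (M := X * U * diagonal (star f))]
      simp [mul_diagonal]
  refine ⟨reflectionBlock U X μ, t, fun k => ?_, fun k => ?_, ?_, ?_, ?_⟩
  · simp only [t]
    split_ifs
    · exact hμ k
    · rw [norm_star, hμ k]
  · simp only [t]
    split_ifs with h
    · exact h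
    · simpa using (not_le.1 h).le
  · ext i j
    rw [Matrix.sum_apply]
    have e : ∀ k, ((reflectionBlock U X μ k)ᴴ * reflectionBlock U X μ k) i j
        = 1 / 2 * (U i k * Uᴴ k j + (X * U) i k * (Uᴴ * X) k j) := fun k => by
      have e := congrFun (congrFun herm i) k
      rw [conjTranspose_apply] at e
      rw [← inv_sqrt_two_mul_self, ← e]
      unfold reflectionBlock
      split_ifs <;>
      simp [Matrix.mul_apply, Fin.sum_univ_two] <;> ring
    simp only [e]
    rw [← Finset.mul_sum, Finset.sum_add_distrib, ← Matrix.mul_apply, ← Matrix.mul_apply, hU2,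
      ← mul_assoc, mul_assoc X, hU2, mul_one, hX2]
    ring
  · have := total 1
    simp only [Pi.one_apply, star_one, ite_self] at this
    rw [this, show diagonal (1 : n → ℂ) = 1 from diagonal_one, mul_one, hU2, one_mul, mul_one]
    module
  · rw [total μ, ← hT]
    have : U * diagonal (star μ) * Uᴴ = X * Y := by
      have h := congrArg conjTranspose hT
      rw [conjTranspose_mul, hX.eq, hY.eq] at h
      rw [h]
      simp [mul_assoc]
    rw [this, mul_assoc, hX2, ← mul_assoc, hX2, mul_one, one_mul]
    module

/-- Jordan's lemma for a pair of two-outcome measurements: dilate the two observables one after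
the other to reflections, decompose these, and compress. -/
theorem exists_qubit_blocks {n : Type*} [Fintype n] [DecidableEq n]
    {P Q : Fin 2 → Matrix n n ℂ} (hP : IsPOVM P) (hQ : IsPOVM Q) :
    ∃ (N : (n ⊕ n) ⊕ (n ⊕ n) → Matrix (Fin 2) n ℂ) (t : (n ⊕ n) ⊕ (n ⊕ n) → ℂ),
      (∀ k, ‖t k‖ = 1) ∧ (∀ k, 0 ≤ (t k).im) ∧ ∑ k, (N k)ᴴ * N k = 1 ∧
      ∑ k, (N k)ᴴ * planeObs 1 * N k = P 0 - P 1 ∧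
      ∑ k, (N k)ᴴ * planeObs (t k) * N k = Q 0 - Q 1 := by
  obtain ⟨hA, D, hD, hAD, hADc⟩ := exists_complement_of_isPOVM hP
  obtain ⟨hB, E, hE, hBE, hBEc⟩ := exists_complement_of_isPOVM hQ
  set A := P 0 - P 1
  set B := Q 0 - Q 1
  let X₀ := fromBlocks A D D (-A)
  let X := fromBlocks X₀ 0 0 X₀
  let Y := fromBlocks (fromBlocks B 0 0 B) (fromBlocks E 0 0 E) (fromBlocks E 0 0 E)
    (-fromBlocks B 0 0 B)
  have hX : X.IsHermitian := by
    simp [X, X₀, IsHermitian, fromBlocks_conjTranspose, hA.eq, hD.eq]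
  have hY : Y.IsHermitian := by
    simp [Y, IsHermitian, fromBlocks_conjTranspose, hB.eq, hE.eq]
  have hX2 : X * X = 1 := by
    have : D * D + A * A = 1 := by rw [add_comm, hAD]
    simp [X, X₀, fromBlocks_multiply, hAD, hADc, this]
  have hY2 : Y * Y = 1 := by
    have : E * E + B * B = 1 := by rw [add_comm, hBE]
    simp [Y, fromBlocks_multiply, hBE, hBEc, fromBlocks_add, this]
  obtain ⟨N, t, h1, h2, h3, h4, h5⟩ := exists_qubit_blocks_of_reflections hX hY hX2 hY2
  let ι : n → (n ⊕ n) ⊕ (n ⊕ n) := fun i => Sum.inl (Sum.inl i)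
  have compress : ∀ (f : (n ⊕ n) ⊕ (n ⊕ n) → Matrix (Fin 2) (Fin 2) ℂ),
      ∑ k, ((N k).submatrix id ι)ᴴ * f k * (N k).submatrix id ι
      = (∑ k, (N k)ᴴ * f k * N k).submatrix ι ι := fun f => by
    ext i j
    simp only [Matrix.sum_apply, submatrix_apply]
    rfl
  refine ⟨fun k => (N k).submatrix id ι, t, h1, h2, ?_, ?_, ?_⟩
  · have := compress fun _ => 1
    simp only [Matrix.mul_one, h3] at this
    rw [this]
    exact submatrix_one _ fun i j h => by simpa [ι] using h
  · rw [compress, h4]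
    rfl
  · rw [compress, h5]
    rfl

/-! ### Identification of the Bell states -/

theorem apply_eq_zero_of_diag_left {n : Type*} {M : Matrix n n ℂ} (hM : M.PosSemidef)
    {i : n} (h : (M i i).re = 0) (j : n) : M i j = 0 ∧ M j i = 0 := by
  have h1 := norm_sq_apply_le_of_posSemidef hM i j
  have h2 := norm_sq_apply_le_of_posSemidef hM j i
  rw [h, zero_mul] at h1
  rw [h, mul_zero] at h2
  exact ⟨norm_eq_zero.1 (pow_eq_zero_iff two_ne_zero |>.1 (le_antisymm h1 (sq_nonneg _))),
    norm_eq_zero.1 (pow_eq_zero_iff two_ne_zero |>.1 (le_antisymm h2 (sq_nonneg _)))⟩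

/-- A coherence that saturates its bound in modulus and has phase `±1` determines the corresponding
two-by-two principal submatrix. -/
theorem coherence_eq_of_saturated {n : Type*} {M : Matrix n n ℂ} (hM : M.PosSemidef) {p q : n}
    {ε : ℝ} (hε : ε ^ 2 = 1) (h : 2 * (M p q).re = ε * ((M p p).re + (M q q).re)) :
    M q q = M p p ∧ M p q = ε * M p p ∧ M q p = ε * M p p := by
  have hpq := norm_sq_apply_le_of_posSemidef hM p q
  rw [Complex.sq_norm, Complex.normSq_apply] at hpq
  have hp := (Complex.nonneg_iff.1 (hM.diag_nonneg (i := p))).2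
  have hq := (Complex.nonneg_iff.1 (hM.diag_nonneg (i := q))).2
  have h2 : 4 * ((M p q).re * (M p q).re) = ((M p p).re + (M q q).re) ^ 2 := by
    calc 4 * ((M p q).re * (M p q).re) = (2 * (M p q).re) ^ 2 := by ring
      _ = _ := by rw [h, mul_pow, hε, one_mul]
  have him : (M p q).im = 0 := by nlinarith [sq_nonneg ((M p p).re - (M q q).re)]
  have hd : (M q q).re = (M p p).re := by nlinarith [sq_nonneg ((M p p).re - (M q q).re)]
  have hpq' : M p q = ε * M p p := by
    apply Complex.ext
    · rw [hd] at h
      simp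
      linarith
    · simp [him, ← hp]
  refine ⟨Complex.ext hd (by rw [← hp, ← hq]), hpq', ?_⟩
  rw [← hM.1.apply q p, hpq']
  apply Complex.ext <;> simp [← hp]

/-- The Pauli matrix `σ_z`. -/
def pauliZ : Matrix (Fin 2) (Fin 2) ℂ := !![1, 0; 0, -1]

/-- The Pauli matrix `σ_x`. -/
def pauliX : Matrix (Fin 2) (Fin 2) ℂ := !![0, 1; 1, 0]

theorem sqrt_two_mul_self : ((√2 : ℝ) : ℂ) * ((√2 : ℝ) : ℂ) = 2 := by
  rw [← Complex.ofReal_mul, Real.mul_self_sqrt (by norm_num)]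
  norm_num

theorem bellProj_apply (b p q : Fin 2 × Fin 2) : bellProj b p q =
    if p.2 = p.1 + b.1 ∧ q.2 = q.1 + b.1 then
      (-1) ^ ((p.1 : ℕ) * (b.2 : ℕ)) * (-1) ^ ((q.1 : ℕ) * (b.2 : ℕ)) / 2 else 0 := by
  simp only [bellProj, vecMulVec_apply, bellVec, Pi.star_apply]
  by_cases hp : p.2 = p.1 + b.1
  · by_cases hq : q.2 = q.1 + b.1
    · rw [if_pos hp, if_pos hq, if_pos ⟨hp, hq⟩]
      simp only [star_div₀, star_pow, star_neg, star_one, Complex.star_def, Complex.conj_ofReal]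
      rw [div_mul_div_comm, sqrt_two_mul_self]
    · simp [hq]
  · simp [hp]

/-- The Bell vectors are determined by their stabilisers `σ_z ⊗ σ_z` and `σ_x ⊗ σ_x`. -/
theorem eq_smul_bellProj {M : Matrix (Fin 2 × Fin 2) (Fin 2 × Fin 2) ℂ} (hM : M.PosSemidef)
    (b : Fin 2 × Fin 2)
    (hz : (M * (pauliZ ⊗ₖ pauliZ)).trace.re = (-1) ^ (b.1 : ℕ) * M.trace.re)
    (hx : (M * (pauliX ⊗ₖ pauliX)).trace.re = (-1) ^ (b.2 : ℕ) * M.trace.re) :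
    M = M.trace • bellProj b := by
  obtain ⟨b₀, b₁⟩ := b
  have d := fun i => diag_re_nonneg hM i
  have hε : ((-1 : ℝ) ^ (b₁ : ℕ)) ^ 2 = 1 := by rw [← pow_mul, mul_comm, pow_mul]; simp
  have r1 : (M (0, 0) (1, 1)).re = (M (1, 1) (0, 0)).re := by
    rw [← hM.1.apply (0, 0) (1, 1)]; simp
  have r2 : (M (0, 1) (1, 0)).re = (M (1, 0) (0, 1)).re := by
    rw [← hM.1.apply (0, 1) (1, 0)]; simp
  rw [trace_two_qubit] at hz hx ⊢
  simp only [Matrix.trace, Matrix.diag, Matrix.mul_apply, Fintype.sum_prod_type,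
    Fin.sum_univ_two, Matrix.kroneckerMap_apply, pauliZ, pauliX] at hz hx
  simp at hz hx
  have d0 := d (0, 0)
  have d1 := d (0, 1)
  have d2 := d (1, 0)
  have d3 := d (1, 1)
  fin_cases b₀
  · simp at hz
    have z1 := apply_eq_zero_of_diag_left hM (show (M (0, 1) (0, 1)).re = 0 by linarith)
    have z2 := apply_eq_zero_of_diag_left hM (show (M (1, 0) (1, 0)).re = 0 by linarith)
    obtain ⟨c1, c2, c3⟩ := coherence_eq_of_saturated hM (p := (0, 0)) (q := (1, 1)) hε (by
      simp [z1, z2] at hx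
      linarith)
    ext ⟨i, j⟩ ⟨k, l⟩
    rw [Matrix.smul_apply, bellProj_apply]
    fin_cases i <;> fin_cases j <;> fin_cases k <;> fin_cases l <;>
      simp [z1, z2, c1, c2, c3] <;> fin_cases b₁ <;> (try simp) <;> ring
  · simp at hz
    have z1 := apply_eq_zero_of_diag_left hM (show (M (0, 0) (0, 0)).re = 0 by linarith)
    have z2 := apply_eq_zero_of_diag_left hM (show (M (1, 1) (1, 1)).re = 0 by linarith)
    obtain ⟨c1, c2, c3⟩ := coherence_eq_of_saturated hM (p := (0, 1)) (q := (1, 0)) hε (by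
      simp [z1, z2] at hx
      linarith)
    ext ⟨i, j⟩ ⟨k, l⟩
    rw [Matrix.smul_apply, bellProj_apply]
    fin_cases i <;> fin_cases j <;> fin_cases k <;> fin_cases l <;>
      simp [z1, z2, c1, c2, c3] <;> fin_cases b₁ <;> (try simp) <;> ring

/-- A mixture of the four Bell projectors that is a product is the maximally mixed state. The
off-diagonal entries equate the weights of the two Bell states in each eigenspace of `σ_z ⊗ σ_z`,
and the diagonal, being a product, equates the two eigenspaces. -/
theorem weight_eq_of_sum_bellProj_eq_kronecker {p : Fin 2 × Fin 2 → ℝ} (hp : ∀ b, 0 < p b)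
    {R S : Matrix (Fin 2) (Fin 2) ℂ} (h : ∑ b, (p b : ℂ) • bellProj b = R ⊗ₖ S)
    (hp1 : ∑ b, p b = 1) (b : Fin 2 × Fin 2) : p b = 1 / 4 := by
  have e := fun i j : Fin 2 × Fin 2 => congrFun (congrFun h i) j
  simp only [Matrix.sum_apply, Matrix.smul_apply, bellProj_apply, Fintype.sum_prod_type,
    Fin.sum_univ_two, kroneckerMap_apply] at e
  simp only [Fintype.sum_prod_type, Fin.sum_univ_two] at hp1
  have q1 := hp (0, 0)
  have q2 := hp (0, 1)
  have q3 := hp (1, 0)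
  have q4 := hp (1, 1)
  have e1 := e (0, 0) (0, 0)
  have e2 := e (1, 1) (1, 1)
  have e3 := e (0, 1) (0, 1)
  have e4 := e (1, 0) (1, 0)
  have e5 := e (0, 0) (0, 1)
  have e6 := e (0, 1) (0, 0)
  have e7 := e (0, 0) (1, 1)
  have e8 := e (0, 1) (1, 0)
  simp at e1 e2 e3 e4 e5 e6 e7 e8
  have hR : R 0 0 ≠ 0 := fun h0 => by
    rw [h0, zero_mul] at e1
    have := congrArg Complex.re e1
    simp at this
    linarith
  have s1 : S 0 1 = 0 := e5.resolve_left hR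
  have s2 : S 1 0 = 0 := e6.resolve_left hR
  rw [s1, mul_zero] at e7
  rw [s2, mul_zero] at e8
  have f7 : p (0, 0) = p (0, 1) := by
    have := congrArg Complex.re e7
    simp at this
    linarith
  have f8 : p (1, 0) = p (1, 1) := by
    have := congrArg Complex.re e8
    simp at this
    linarith
  have prod : ((p (0, 0) / 2 + p (0, 1) / 2 : ℝ) : ℂ) * ((p (0, 0) / 2 + p (0, 1) / 2 : ℝ) : ℂ)
      = ((p (1, 0) / 2 + p (1, 1) / 2 : ℝ) : ℂ) * ((p (1, 0) / 2 + p (1, 1) / 2 : ℝ) : ℂ) := by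
    push_cast
    linear_combination (p (0, 0) / 2 + p (0, 1) / 2 : ℂ) * e1 + (R 0 0 * S 0 0) * e2
      - (p (1, 0) / 2 + p (1, 1) / 2 : ℂ) * e3 - (R 0 0 * S 1 1) * e4
  have prod' : (p (0, 0) / 2 + p (0, 1) / 2) * (p (0, 0) / 2 + p (0, 1) / 2)
      = (p (1, 0) / 2 + p (1, 1) / 2) * (p (1, 0) / 2 + p (1, 1) / 2) := by exact_mod_cast prod
  have f9 := (mul_self_inj (by positivity) (by positivity)).1 prod'
  obtain ⟨b₀, b₁⟩ := b
  fin_cases b₀ <;> fin_cases b₁ <;> simp <;> linarith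

/-! ### Extraction of the Bell states from the conditional states -/

theorem sum_kronecker_sum {ι κ l m n p : Type*} [Fintype ι] [Fintype κ]
    (X : ι → Matrix l m ℂ) (Y : κ → Matrix n p ℂ) :
    ∑ i, ∑ k, X i ⊗ₖ Y k = (∑ i, X i) ⊗ₖ (∑ k, Y k) := by
  ext ⟨a, b⟩ ⟨c, d⟩
  simp only [Matrix.sum_apply, kroneckerMap_apply, Finset.sum_mul_sum]

/-- The local Kraus operators may be moved from the state to the local observables. -/
theorem sum_trace_conj_kronecker {κ ι m n m' n' : Type*} [Fintype κ] [Fintype ι] [Fintype m]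
    [Fintype n] [Fintype m'] [Fintype n'] (N : κ → Matrix m n ℂ) (N' : ι → Matrix m' n' ℂ)
    (M : Matrix (n × n') (n × n') ℂ) (F : κ → Matrix m m ℂ) (F' : ι → Matrix m' m' ℂ) :
    ∑ k, ∑ l, ((N k ⊗ₖ N' l) * M * (N k ⊗ₖ N' l)ᴴ * (F k ⊗ₖ F' l)).trace =
      (M * ((∑ k, (N k)ᴴ * F k * N k) ⊗ₖ (∑ l, (N' l)ᴴ * F' l * N' l))).trace := by
  rw [← sum_kronecker_sum]
  simp only [Finset.mul_sum, trace_sum]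
  refine Finset.sum_congr rfl fun k _ => Finset.sum_congr rfl fun l _ => ?_
  rw [Matrix.mul_assoc _ M, Matrix.mul_assoc (N k ⊗ₖ N' l), Matrix.trace_mul_comm,
    Matrix.mul_assoc, Matrix.mul_assoc, conjTranspose_kronecker, ← mul_kronecker_mul,
    ← mul_kronecker_mul, Matrix.mul_assoc, Matrix.mul_assoc]

theorem sum_trace_conj_kronecker_eq_trace {κ ι m n m' n' : Type*} [Fintype κ] [Fintype ι]
    [Fintype m] [Fintype n] [Fintype m'] [Fintype n'] [DecidableEq m] [DecidableEq m']
    [DecidableEq n] [DecidableEq n'] {N : κ → Matrix m n ℂ} {N' : ι → Matrix m' n' ℂ}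
    (hN : ∑ k, (N k)ᴴ * N k = 1) (hN' : ∑ l, (N' l)ᴴ * N' l = 1)
    (M : Matrix (n × n') (n × n') ℂ) :
    ∑ k, ∑ l, ((N k ⊗ₖ N' l) * M * (N k ⊗ₖ N' l)ᴴ).trace = M.trace := by
  have := sum_trace_conj_kronecker N N' M (fun _ => 1) (fun _ => 1)
  simpa [hN, hN'] using this

theorem sum_trace_conj_eq_one {m n κ : Type*} [Fintype m] [Fintype n] [DecidableEq n] [Fintype κ]
    {K : κ → Matrix m n ℂ} {Y : Matrix n n ℂ} (hK : ∑ k, (K k)ᴴ * K k = 1) (hY : IsDensity Y) :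
    ∑ k, (K k * Y * (K k)ᴴ).trace.re = 1 := by
  rw [← Complex.re_sum, ← trace_sum]
  have : (∑ k, K k * Y * (K k)ᴴ).trace = ((∑ k, (K k)ᴴ * K k) * Y).trace := by
    simp only [trace_sum, Finset.sum_mul]
    refine Finset.sum_congr rfl fun k _ => ?_
    rw [Matrix.trace_mul_comm, ← Matrix.mul_assoc]
  rw [this, hK, Matrix.one_mul, hY.trace_eq_one, Complex.one_re]

theorem sum_conj_mul {m n κ : Type*} [Fintype m] [Fintype κ] (K : κ → Matrix m n ℂ)
    (G F : Matrix m m ℂ) :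
    ∑ k, (G * K k)ᴴ * F * (G * K k) = ∑ k, (K k)ᴴ * (Gᴴ * F * G) * K k := by
  simp only [conjTranspose_mul, Matrix.mul_assoc]

/-- The unitary of the first outer party that turns `planeObs 1` into `σ_z` and
`planeObs Complex.I` into `σ_x`. -/
noncomputable def rotLeft : Matrix (Fin 2) (Fin 2) ℂ :=
  ((√2 : ℝ) : ℂ)⁻¹ • !![1, 1; -Complex.I, Complex.I]

/-- The unitary of the second outer party that turns `planeObs 1` into `σ_x` and
`planeObs Complex.I` into `σ_z`. -/
noncomputable def rotRight : Matrix (Fin 2) (Fin 2) ℂ :=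
  ((√2 : ℝ) : ℂ)⁻¹ • !![1, Complex.I; Complex.I, 1]

theorem inv_sqrt_two_smul_conj (M : Matrix (Fin 2) (Fin 2) ℂ) (F : Matrix (Fin 2) (Fin 2) ℂ) :
    (((√2 : ℝ) : ℂ)⁻¹ • M)ᴴ * F * (((√2 : ℝ) : ℂ)⁻¹ • M) = (1 / 2 : ℂ) • (Mᴴ * F * M) := by
  rw [← inv_sqrt_two_mul_self, conjTranspose_smul, star_inv₀, Complex.star_def,
    Complex.conj_ofReal, Matrix.smul_mul, Matrix.smul_mul, Matrix.mul_smul, smul_smul]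

theorem rotLeft_conj_one : rotLeftᴴ * rotLeft = 1 := by
  have := inv_sqrt_two_smul_conj !![1, 1; -Complex.I, Complex.I] 1
  rw [Matrix.mul_one, Matrix.mul_one] at this
  rw [rotLeft, this]
  ext i j; fin_cases i <;> fin_cases j <;> simp [Matrix.mul_apply] <;> norm_num

theorem rotLeft_conj_pauliZ : rotLeftᴴ * pauliZ * rotLeft = planeObs 1 := by
  rw [rotLeft, inv_sqrt_two_smul_conj]
  ext i j; fin_cases i <;> fin_cases j <;> simp [Matrix.mul_apply, pauliZ, planeObs] <;> norm_num

theorem rotLeft_conj_pauliX : rotLeftᴴ * pauliX * rotLeft = planeObs Complex.I := by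
  rw [rotLeft, inv_sqrt_two_smul_conj]
  ext i j; fin_cases i <;> fin_cases j <;> simp [Matrix.mul_apply, pauliX, planeObs] <;> ring

theorem rotRight_conj_one : rotRightᴴ * rotRight = 1 := by
  have := inv_sqrt_two_smul_conj !![1, Complex.I; Complex.I, 1] 1
  rw [Matrix.mul_one, Matrix.mul_one] at this
  rw [rotRight, this]
  ext i j; fin_cases i <;> fin_cases j <;> simp [Matrix.mul_apply] <;> norm_num

theorem rotRight_conj_pauliX : rotRightᴴ * pauliX * rotRight = planeObs 1 := by
  rw [rotRight, inv_sqrt_two_smul_conj]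
  ext i j; fin_cases i <;> fin_cases j <;> simp [Matrix.mul_apply, pauliX, planeObs] <;> norm_num

theorem rotRight_conj_pauliZ : rotRightᴴ * pauliZ * rotRight = planeObs Complex.I := by
  rw [rotRight, inv_sqrt_two_smul_conj]
  ext i j; fin_cases i <;> fin_cases j <;> simp [Matrix.mul_apply, pauliZ, planeObs] <;> ring

/-- The unnormalised states `Ω b` of the two outer parties, conditioned on the outcome of the
central party, contain the Bell states with equal weights: local channels extract them. The
channels compress to the qubit blocks and rotate; as all blocks of nonzero weight are ideal, the
measured correlations fix the expectation values of the two stabilisers of each Bell state. -/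
theorem exists_bell_extraction {a c : Type*} [Fintype a] [Fintype c] [DecidableEq a]
    [DecidableEq c] {A : Fin 2 → Fin 2 → Matrix a a ℂ} (hA : ∀ x, IsPOVM (A x))
    {C : Fin 2 → Fin 2 → Matrix c c ℂ} (hC : ∀ z, IsPOVM (C z))
    {Ω : Fin 2 × Fin 2 → Matrix (a × c) (a × c) ℂ} (hΩ : ∀ b, (Ω b).PosSemidef)
    {R : Matrix a a ℂ} {S : Matrix c c ℂ} (hR : IsDensity R) (hS : IsDensity S)
    (hsum : ∑ b, Ω b = R ⊗ₖ S) (hpos : ∀ b, 0 < (Ω b).trace.re)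
    {δ : ℝ} (hδ0 : δ ≠ 0) (hδ : |δ| ≤ Real.pi / 6)
    (h00 : ∀ b, ((Ω b) * ((A 0 0 - A 0 1) ⊗ₖ (C 0 0 - C 0 1))).trace.re = 0)
    (h01 : ∀ b, ((Ω b) * ((A 0 0 - A 0 1) ⊗ₖ (C 1 0 - C 1 1))).trace.re =
      (-1) ^ (b.1 : ℕ) * Real.cos δ * (Ω b).trace.re)
    (h10 : ∀ b, ((Ω b) * ((A 1 0 - A 1 1) ⊗ₖ (C 0 0 - C 0 1))).trace.re =
      (-1) ^ (b.2 : ℕ) * Real.cos δ * (Ω b).trace.re)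
    (h11 : ∀ b, ((Ω b) * ((A 1 0 - A 1 1) ⊗ₖ (C 1 0 - C 1 1))).trace.re =
      (if b.1 = b.2 then (-1) ^ (b.1 : ℕ) * Real.sin (2 * δ) else 0) * (Ω b).trace.re) :
    ∃ (V : (a ⊕ a) ⊕ (a ⊕ a) → Matrix (Fin 2) a ℂ) (W : (c ⊕ c) ⊕ (c ⊕ c) → Matrix (Fin 2) c ℂ),
      ∑ k, (V k)ᴴ * V k = 1 ∧ ∑ l, (W l)ᴴ * W l = 1 ∧
      ∀ b, ∑ k, ∑ l, (V k ⊗ₖ W l) * Ω b * (V k ⊗ₖ W l)ᴴ = (1 / 4 : ℂ) • bellProj b := by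
  obtain ⟨N, t, ht, ht0, hN, hN1, hNt⟩ := exists_qubit_blocks (hA 0) (hA 1)
  obtain ⟨N', r, hr, hr0, hN', hN1', hNr⟩ := exists_qubit_blocks (hC 0) (hC 1)
  set ω : Fin 2 × Fin 2 → _ → _ → Matrix (Fin 2 × Fin 2) (Fin 2 × Fin 2) ℂ :=
    fun b k l => (N k ⊗ₖ N' l) * Ω b * (N k ⊗ₖ N' l)ᴴ with hω
  have htr : ∀ b, ∑ k, ∑ l, (ω b k l).trace.re = (Ω b).trace.re := fun b => by
    rw [← sum_trace_conj_kronecker_eq_trace hN hN' (Ω b)]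
    simp [hω]
  have hcorr : ∀ b (u : _ → ℂ) (v : _ → ℂ), ∑ k, ∑ l, planeCorr (ω b k l) (u k) (v l) =
      ((Ω b) * ((∑ k, (N k)ᴴ * planeObs (u k) * N k) ⊗ₖ
        (∑ l, (N' l)ᴴ * planeObs (v l) * N' l))).trace.re := fun b u v => by
    rw [← sum_trace_conj_kronecker]
    simp [hω, planeCorr]
  have hblockSum : ∀ (K : Matrix (Fin 2) a ℂ) (K' : Matrix (Fin 2) c ℂ),
      ∑ b, (K ⊗ₖ K') * Ω b * (K ⊗ₖ K')ᴴ = (K * R * Kᴴ) ⊗ₖ (K' * S * K'ᴴ) := fun K K' => by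
    rw [← Matrix.sum_mul, ← Matrix.mul_sum, hsum, conjTranspose_kronecker,
      ← mul_kronecker_mul, ← mul_kronecker_mul]
  have hblock : IsBlockModel δ t r ω (fun k => N k * R * (N k)ᴴ)
      (fun l => N' l * S * (N' l)ᴴ) := by
    refine ⟨ht, hr, fun b k l => (hΩ b).mul_mul_conjTranspose_same _,
      fun k => hR.posSemidef.mul_mul_conjTranspose_same _,
      fun l => hS.posSemidef.mul_mul_conjTranspose_same _, ?_, sum_trace_conj_eq_one hN hR,
      sum_trace_conj_eq_one hN' hS, ?_, ?_, ?_, ?_, ?_⟩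
    · exact fun k l => hblockSum (N k) (N' l)
    · intro b
      rw [htr]
      exact hpos b
    · intro b
      rw [hcorr b (fun _ => 1) (fun _ => 1), hN1, hN1', h00]
    · intro b
      rw [hcorr b (fun _ => 1) r, hN1, hNr, h01, htr]
    · intro b
      rw [hcorr b t (fun _ => 1), hNt, hN1', h10, htr]
    · intro b
      rw [hcorr b t r, hNt, hNr, h11, htr]
  obtain ⟨hleft, hright⟩ := hblock.re_eq_sin hδ0 hδ
  have hc : 0 < Real.cos δ := by
    have hπ := Real.pi_pos
    obtain ⟨h1, h2⟩ := abs_le.1 hδ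
    exact Real.cos_pos_of_mem_Ioo ⟨by linarith, by linarith⟩
  -- A unit vector in the upper half-plane is determined by its real part.
  have hunit : ∀ z : ℂ, ‖z‖ = 1 → 0 ≤ z.im → z.re = Real.sin δ →
      z = (Real.sin δ : ℝ) * 1 + (Real.cos δ : ℝ) * Complex.I := fun z h1 h2 h3 => by
    have h4 := Complex.sq_norm z
    rw [h1, Complex.normSq_apply, h3] at h4
    have h5 : z.im = Real.cos δ := by
      refine (mul_self_inj h2 hc.le).1 ?_
      nlinarith [Real.sin_sq_add_cos_sq δ]
    apply Complex.ext <;> simp [h3, h5, -Complex.ofReal_sin, -Complex.ofReal_cos]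
  -- blocks of weight zero do not contribute, so that every block may be taken to be ideal
  have hzero : ∀ b k l, N k * R * (N k)ᴴ = 0 ∨ N' l * S * (N' l)ᴴ = 0 → ω b k l = 0 := by
    intro b k l h
    have h1 := hblock.sum_eq k l
    have h2 : (N k * R * (N k)ᴴ) ⊗ₖ (N' l * S * (N' l)ᴴ) = 0 := by
      rcases h with h | h <;> simp [h]
    simp only [h2] at h1
    have h3 := congrArg (fun M => M.trace.re) h1
    simp only [trace_sum, Complex.re_sum, trace_zero, Complex.zero_re] at h3
    exact eq_zero_of_trace_re_eq_zero (hblock.posSemidef b k l)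
      ((Finset.sum_eq_zero_iff_of_nonneg fun b _ =>
        trace_re_nonneg (hblock.posSemidef b k l)).1 h3 b (Finset.mem_univ b))
  have hr' : ∀ b k l, planeCorr (ω b k l) 1 (r l) =
      Real.sin δ * planeCorr (ω b k l) 1 1 + Real.cos δ * planeCorr (ω b k l) 1 Complex.I := by
    intro b k l
    by_cases hl : (r l).re = Real.sin δ
    · rw [hunit _ (hr l) (hr0 l) hl, planeCorr_add_right, planeCorr_real_mul_right,
        planeCorr_real_mul_right]
    · rw [hzero b k l (Or.inr (hright l hl))]
      simp [planeCorr]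
  have ht' : ∀ b k l, planeCorr (ω b k l) (t k) 1 =
      Real.sin δ * planeCorr (ω b k l) 1 1 + Real.cos δ * planeCorr (ω b k l) Complex.I 1 := by
    intro b k l
    by_cases hk : (t k).re = Real.sin δ
    · rw [hunit _ (ht k) (ht0 k) hk, planeCorr_add_left, planeCorr_real_mul_left,
        planeCorr_real_mul_left]
    · rw [hzero b k l (Or.inl (hleft k hk))]
      simp [planeCorr]
  have hZ : ∀ b, ∑ k, ∑ l, planeCorr (ω b k l) 1 Complex.I =
      (-1) ^ (b.1 : ℕ) * (Ω b).trace.re := fun b => by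
    have h1 := hblock.corr01 b
    simp only [hr', Finset.sum_add_distrib, ← Finset.mul_sum, hblock.corr00, htr] at h1
    refine mul_left_cancel₀ hc.ne' ?_
    linarith
  have hX : ∀ b, ∑ k, ∑ l, planeCorr (ω b k l) Complex.I 1 =
      (-1) ^ (b.2 : ℕ) * (Ω b).trace.re := fun b => by
    have h1 := hblock.corr10 b
    simp only [ht', Finset.sum_add_distrib, ← Finset.mul_sum, hblock.corr00, htr] at h1
    refine mul_left_cancel₀ hc.ne' ?_
    linarith
  have hV1 : ∑ k, (rotLeft * N k)ᴴ * (rotLeft * N k) = 1 := by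
    have := sum_conj_mul N rotLeft 1
    simpa [rotLeft_conj_one, hN] using this
  have hW1 : ∑ l, (rotRight * N' l)ᴴ * (rotRight * N' l) = 1 := by
    have := sum_conj_mul N' rotRight 1
    simpa [rotRight_conj_one, hN'] using this
  refine ⟨fun k => rotLeft * N k, fun l => rotRight * N' l, hV1, hW1, ?_⟩
  set T : Fin 2 × Fin 2 → Matrix (Fin 2 × Fin 2) (Fin 2 × Fin 2) ℂ := fun b =>
    ∑ k, ∑ l, ((rotLeft * N k) ⊗ₖ (rotRight * N' l)) * Ω b *
      ((rotLeft * N k) ⊗ₖ (rotRight * N' l))ᴴ with hT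
  have hTpos : ∀ b, (T b).PosSemidef := fun b =>
    posSemidef_sum _ fun k _ => posSemidef_sum _ fun l _ =>
      (hΩ b).mul_mul_conjTranspose_same _
  have hTtr : ∀ b, (T b).trace = (Ω b).trace := fun b => by
    rw [← sum_trace_conj_kronecker_eq_trace hV1 hW1 (Ω b)]
    simp only [hT, trace_sum]
  have hTF : ∀ b (F F' : Matrix (Fin 2) (Fin 2) ℂ) (u v : ℂ),
      rotLeftᴴ * F * rotLeft = planeObs u → rotRightᴴ * F' * rotRight = planeObs v →
      (T b * (F ⊗ₖ F')).trace.re = ∑ k, ∑ l, planeCorr (ω b k l) u v := by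
    intro b F F' u v hF hF'
    rw [hcorr b (fun _ => u) (fun _ => v), ← hF, ← hF', ← sum_conj_mul, ← sum_conj_mul,
      ← sum_trace_conj_kronecker]
    simp only [hT, Finset.sum_mul, trace_sum]
  have hTb : ∀ b, T b = (((Ω b).trace.re : ℝ) : ℂ) • bellProj b := fun b => by
    have h1 := eq_smul_bellProj (hTpos b) b
      (by rw [hTF b _ _ _ _ rotLeft_conj_pauliZ rotRight_conj_pauliZ, hZ, hTtr])
      (by rw [hTF b _ _ _ _ rotLeft_conj_pauliX rotRight_conj_pauliX, hX, hTtr])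
    rw [hTtr] at h1
    rw [h1]
    congr 1
    exact Complex.ext rfl (Complex.nonneg_iff.1 (hΩ b).trace_nonneg).2.symm
  have hTsum : ∑ b, (((Ω b).trace.re : ℝ) : ℂ) • bellProj b =
      (∑ k, (rotLeft * N k) * R * (rotLeft * N k)ᴴ) ⊗ₖ
        (∑ l, (rotRight * N' l) * S * (rotRight * N' l)ᴴ) := by
    simp only [← hTb, hT]
    rw [← sum_kronecker_sum, Finset.sum_comm]
    refine Finset.sum_congr rfl fun k _ => ?_
    rw [Finset.sum_comm]
    refine Finset.sum_congr rfl fun l _ => ?_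
    have := hblockSum (rotLeft * N k) (rotRight * N' l)
    exact this
  have hone : ∑ b, (Ω b).trace.re = 1 := by
    rw [← Complex.re_sum, ← trace_sum, hsum, trace_kronecker, hR.trace_eq_one,
      hS.trace_eq_one]
    simp
  intro b
  have := hTb b
  rw [weight_eq_of_sum_bellProj_eq_kronecker hpos hTsum hone b] at this
  rw [show (1 / 4 : ℂ) = ((1 / 4 : ℝ) : ℂ) by norm_num]
  exact this

/-! ### Kraus maps and their tensor products -/

/-- The completely positive map with Kraus operators `W k`. -/
def krausMap {κ n m : Type*} [Fintype κ] [Fintype n] (W : κ → Matrix m n ℂ) :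
    Matrix n n ℂ →ₗ[ℂ] Matrix m m ℂ where
  toFun X := ∑ k, W k * X * (W k)ᴴ
  map_add' X Y := by simp only [Matrix.mul_add, Matrix.add_mul, Finset.sum_add_distrib]
  map_smul' c X := by
    simp only [Matrix.mul_smul, Matrix.smul_mul, Finset.smul_sum, RingHom.id_apply]

theorem krausMap_apply {κ n m : Type*} [Fintype κ] [Fintype n] (W : κ → Matrix m n ℂ)
    (X : Matrix n n ℂ) : krausMap W X = ∑ k, W k * X * (W k)ᴴ := rfl

theorem one_kronecker_conj_apply {n m p : Type*} [Fintype n] [Fintype p] [DecidableEq p]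
    (W : Matrix m n ℂ) (X : Matrix (p × n) (p × n) ℂ) (i i' : p) (k k' : m) :
    ((1 : Matrix p p ℂ) ⊗ₖ W * X * ((1 : Matrix p p ℂ) ⊗ₖ W)ᴴ) (i, k) (i', k') =
      (W * (Matrix.of fun j j' => X (i, j) (i', j')) * Wᴴ) k k' := by
  simp [Matrix.mul_apply, Fintype.sum_prod_type, Matrix.one_apply, ite_mul,
    Finset.sum_ite_eq, apply_ite]

theorem kronecker_one_conj_apply {n m p : Type*} [Fintype n] [Fintype p] [DecidableEq p]
    (W : Matrix m n ℂ) (X : Matrix (n × p) (n × p) ℂ) (i i' : p) (k k' : m) :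
    (W ⊗ₖ (1 : Matrix p p ℂ) * X * (W ⊗ₖ (1 : Matrix p p ℂ))ᴴ) (k, i) (k', i') =
      (W * (Matrix.of fun j j' => X (j, i) (j', i')) * Wᴴ) k k' := by
  simp [Matrix.mul_apply, Fintype.sum_prod_type, Matrix.one_apply, ite_mul,
    Finset.sum_ite_eq, apply_ite]

theorem isCP_krausMap {κ n m : Type*} [Fintype κ] [Fintype n] [Fintype m]
    (W : κ → Matrix m n ℂ) : IsCP (krausMap W) := by
  intro d X hX
  have : (Matrix.of fun p q : Fin d × m =>
      krausMap W (Matrix.of fun i j => X (p.1, i) (q.1, j)) p.2 q.2) =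
      ∑ k, (1 : Matrix (Fin d) (Fin d) ℂ) ⊗ₖ W k * X *
        ((1 : Matrix (Fin d) (Fin d) ℂ) ⊗ₖ W k)ᴴ := by
    ext ⟨i, k⟩ ⟨i', k'⟩
    simp only [Matrix.of_apply, krausMap_apply, Matrix.sum_apply, one_kronecker_conj_apply]
  rw [this]
  exact posSemidef_sum _ fun k _ => hX.mul_mul_conjTranspose_same _

theorem isChannel_krausMap {κ n m : Type*} [Fintype κ] [Fintype n] [Fintype m] [DecidableEq n]
    {W : κ → Matrix m n ℂ} (hW : ∑ k, (W k)ᴴ * W k = 1) : IsChannel (krausMap W) := by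
  refine ⟨isCP_krausMap W, fun X => ?_⟩
  have : (krausMap W X).trace = ((∑ k, (W k)ᴴ * W k) * X).trace := by
    simp only [krausMap_apply, trace_sum, Finset.sum_mul]
    refine Finset.sum_congr rfl fun k _ => ?_
    rw [Matrix.trace_mul_comm, ← Matrix.mul_assoc]
  rw [this, hW, Matrix.one_mul]

theorem eq_sum_smul_single_kronecker_single {n₁ n₂ : Type*} [Fintype n₁] [Fintype n₂]
    [DecidableEq n₁] [DecidableEq n₂] (X : Matrix (n₁ × n₂) (n₁ × n₂) ℂ) :
    X = ∑ i, ∑ j, ∑ k, ∑ l, X (i, k) (j, l) •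
      (Matrix.single i j (1 : ℂ) ⊗ₖ Matrix.single k l (1 : ℂ)) := by
  ext ⟨p, q⟩ ⟨p', q'⟩
  simp only [Matrix.sum_apply, Matrix.smul_apply, kroneckerMap_apply, Matrix.single_apply,
    smul_eq_mul, mul_ite, mul_one, mul_zero, ite_and]
  simp

theorem tensorMap_krausMap {κ κ' n₁ n₂ m₁ m₂ : Type*} [Fintype κ] [Fintype κ'] [Fintype n₁]
    [Fintype n₂] [DecidableEq n₁] [DecidableEq n₂] (W : κ → Matrix m₁ n₁ ℂ)
    (W' : κ' → Matrix m₂ n₂ ℂ) (X : Matrix (n₁ × n₂) (n₁ × n₂) ℂ) :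
    tensorMap (krausMap W) (krausMap W') X =
      krausMap (fun p : κ × κ' => W p.1 ⊗ₖ W' p.2) X := by
  have hprod : ∀ Y Z, krausMap (fun p : κ × κ' => W p.1 ⊗ₖ W' p.2) (Y ⊗ₖ Z) =
      krausMap W Y ⊗ₖ krausMap W' Z := fun Y Z => by
    simp only [krausMap_apply, ← sum_kronecker_sum, Fintype.sum_prod_type,
      conjTranspose_kronecker, mul_kronecker_mul]
  conv_rhs => rw [eq_sum_smul_single_kronecker_single X]
  simp only [map_sum, map_smul, hprod, tensorMap]

theorem conj_mul_submatrix_fst {m n : Type*} [Fintype m] (X : Matrix m n ℂ) :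
    (X.submatrix (Prod.fst : m × Fin 1 → m) id)ᴴ * X.submatrix (Prod.fst : m × Fin 1 → m) id =
      Xᴴ * X := by
  ext i j
  simp [Matrix.mul_apply, Fintype.sum_prod_type]

/-- A state that is turned into `Φ⁺` by local Kraus operators is self-tested, with a
one-dimensional junk system. -/
theorem selfTestsPhiPlus_of_kraus {κ κ' l r : Type*} [Fintype κ] [Fintype κ'] [Fintype l]
    [Fintype r] [DecidableEq l] [DecidableEq r] {ρ : Matrix (l × r) (l × r) ℂ}
    {V : κ → Matrix (Fin 2) l ℂ} {W : κ' → Matrix (Fin 2) r ℂ} (hV : ∑ k, (V k)ᴴ * V k = 1)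
    (hW : ∑ k, (W k)ᴴ * W k = 1)
    (h : krausMap (fun p : κ × κ' => V p.1 ⊗ₖ W p.2) ρ = bellProj (0, 0)) :
    SelfTestsPhiPlus ρ := by
  refine ⟨1, 1, krausMap fun k => (V k).submatrix Prod.fst id,
    krausMap fun k => (W k).submatrix Prod.fst id, 1,
    isChannel_krausMap (by simpa only [conj_mul_submatrix_fst] using hV),
    isChannel_krausMap (by simpa only [conj_mul_submatrix_fst] using hW),
    ⟨Matrix.PosSemidef.one, by simp [Matrix.trace]⟩, ?_⟩
  rw [tensorMap_krausMap]
  ext ⟨⟨i, i₁⟩, ⟨k, k₁⟩⟩ ⟨⟨j, j₁⟩, ⟨l, l₁⟩⟩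
  have h1 := congrFun (congrFun h (i, k)) (j, l)
  have h2 : (1 : Matrix (Fin 1 × Fin 1) (Fin 1 × Fin 1) ℂ) (i₁, k₁) (j₁, l₁) = 1 := by
    rw [Subsingleton.elim (i₁, k₁) (j₁, l₁), Matrix.one_apply_eq]
  simp only [phiPlusJunk, submatrix_apply, Equiv.prodProdProdComm_apply, kroneckerMap_apply, h2,
    mul_one, ← h1]
  simp only [krausMap_apply, Matrix.sum_apply]
  rfl

/-- The local unitary that maps the Bell state `Φ^b` to `Φ⁺`. It acts on the second qubit; acting on
the first qubit instead, it has the same effect up to a sign. -/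
def bellCorrection (b : Fin 2 × Fin 2) : Matrix (Fin 2) (Fin 2) ℂ :=
  Matrix.of fun i j => if j = i + b.1 then (-1) ^ ((i : ℕ) * (b.2 : ℕ)) else 0

theorem bellCorrection_conj_mul (b : Fin 2 × Fin 2) :
    (bellCorrection b)ᴴ * bellCorrection b = 1 := by
  obtain ⟨b₀, b₁⟩ := b
  ext i j
  fin_cases b₀ <;> fin_cases b₁ <;> fin_cases i <;> fin_cases j <;>
    simp [Matrix.mul_apply, bellCorrection]

theorem one_kronecker_bellCorrection_conj (b : Fin 2 × Fin 2) :
    (1 : Matrix (Fin 2) (Fin 2) ℂ) ⊗ₖ bellCorrection b * bellProj b *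
      ((1 : Matrix (Fin 2) (Fin 2) ℂ) ⊗ₖ bellCorrection b)ᴴ = bellProj (0, 0) := by
  obtain ⟨b₀, b₁⟩ := b
  ext ⟨i, k⟩ ⟨i', k'⟩
  rw [one_kronecker_conj_apply, bellProj_apply]
  simp only [Matrix.mul_apply, Fin.sum_univ_two, Matrix.of_apply, bellProj_apply,
    bellCorrection, conjTranspose_apply]
  fin_cases b₀ <;> fin_cases b₁ <;> fin_cases i <;> fin_cases k <;> fin_cases i' <;>
    fin_cases k' <;> simp <;> norm_num

theorem bellCorrection_kronecker_one_conj (b : Fin 2 × Fin 2) :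
    bellCorrection b ⊗ₖ (1 : Matrix (Fin 2) (Fin 2) ℂ) * bellProj b *
      (bellCorrection b ⊗ₖ (1 : Matrix (Fin 2) (Fin 2) ℂ))ᴴ = bellProj (0, 0) := by
  obtain ⟨b₀, b₁⟩ := b
  ext ⟨i, k⟩ ⟨i', k'⟩
  rw [kronecker_one_conj_apply, bellProj_apply]
  simp only [Matrix.mul_apply, Fin.sum_univ_two, Matrix.of_apply, bellProj_apply,
    bellCorrection, conjTranspose_apply]
  fin_cases b₀ <;> fin_cases b₁ <;> fin_cases i <;> fin_cases k <;> fin_cases i' <;>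
    fin_cases k' <;> simp <;> norm_num

theorem sum_bellProj : ∑ b, bellProj b = 1 := by
  ext ⟨i, k⟩ ⟨i', k'⟩
  simp only [Fintype.sum_prod_type, Fin.sum_univ_two, Matrix.add_apply, bellProj_apply,
    Matrix.one_apply]
  fin_cases i <;> fin_cases k <;> fin_cases i' <;> fin_cases k' <;> simp <;> norm_num

theorem bellProj_transpose (b : Fin 2 × Fin 2) : (bellProj b)ᵀ = bellProj b := by
  ext p q
  simp only [transpose_apply, bellProj_apply, and_comm, mul_comm]

/-! ### Conditional states and teleportation -/

/-- The unnormalised state of the two outer parties, conditioned on the central effect `B`: the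
partial trace of `(ρ ⊗ σ) (1 ⊗ B ⊗ 1)` over the central party. -/
def condState {a b₁ b₂ c : Type*} [Fintype b₁] [Fintype b₂]
    (ρ : Matrix (a × b₁) (a × b₁) ℂ) (σ : Matrix (b₂ × c) (b₂ × c) ℂ)
    (B : Matrix (b₁ × b₂) (b₁ × b₂) ℂ) : Matrix (a × c) (a × c) ℂ :=
  Matrix.of fun p q => ∑ j, ∑ j', ∑ l, ∑ l',
    ρ (p.1, j) (q.1, j') * σ (l, p.2) (l', q.2) * B (j', l') (j, l)

/-- The reduced state of the first tensor factor. -/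
def reduced {α β : Type*} [Fintype β] (M : Matrix (α × β) (α × β) ℂ) : Matrix α α ℂ :=
  ∑ j, M.submatrix (fun i => (i, j)) (fun i => (i, j))

theorem IsDensity.reduced {α β : Type*} [Fintype α] [Fintype β] {M : Matrix (α × β) (α × β) ℂ}
    (h : IsDensity M) : IsDensity (reduced M) := by
  refine ⟨posSemidef_sum _ fun j _ => h.posSemidef.submatrix _, ?_⟩
  rw [← h.trace_eq_one, Bilocal.reduced, trace_sum]
  simp only [Matrix.trace, Matrix.diag, submatrix_apply, Fintype.sum_prod_type]
  exact Finset.sum_comm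

/-- Exchange of the two tensor factors. -/
def swapped {α β : Type*} (M : Matrix (α × β) (α × β) ℂ) : Matrix (β × α) (β × α) ℂ :=
  M.submatrix Prod.swap Prod.swap

theorem IsDensity.swapped {α β : Type*} [Fintype α] [Fintype β] {M : Matrix (α × β) (α × β) ℂ}
    (h : IsDensity M) : IsDensity (swapped M) := by
  refine ⟨h.posSemidef.submatrix _, ?_⟩
  rw [← h.trace_eq_one]
  simp only [Matrix.trace, Matrix.diag, Bilocal.swapped, submatrix_apply]
  exact (Equiv.prodComm β α).sum_comp fun i => M i i

theorem born_eq_trace_condState {a b₁ b₂ c : Type*} [Fintype a] [Fintype b₁] [Fintype b₂]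
    [Fintype c] (ρ : Matrix (a × b₁) (a × b₁) ℂ)
    (σ : Matrix (b₂ × c) (b₂ × c) ℂ) (A : Matrix a a ℂ) (B : Matrix (b₁ × b₂) (b₁ × b₂) ℂ)
    (C : Matrix c c ℂ) : born ρ σ A B C = (condState ρ σ B * (A ⊗ₖ C)).trace.re := by
  rw [born]
  congr 1
  simp only [Matrix.trace, Matrix.diag, Matrix.mul_apply, Fintype.sum_prod_type,
    kroneckerMap_apply, jointEffect, condState, Matrix.of_apply, Finset.sum_mul]
  refine Finset.sum_congr rfl fun i _ => ?_
  simp only [← Fintype.sum_prod_type']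
  exact Finset.sum_nbij' (fun ⟨j, l, k, i', j', l', k'⟩ => (k, i', k', j, j', l, l'))
    (fun ⟨k, i', k', j, j', l, l'⟩ => (j, l, k, i', j', l', k')) (by simp) (by simp)
    (by simp) (by simp) (by rintro ⟨j, l, k, i', j', l', k'⟩ -; ring)

theorem condState_sum {ι a b₁ b₂ c : Type*} [Fintype ι] [Fintype b₁] [Fintype b₂]
    (ρ : Matrix (a × b₁) (a × b₁) ℂ)
    (σ : Matrix (b₂ × c) (b₂ × c) ℂ) (B : ι → Matrix (b₁ × b₂) (b₁ × b₂) ℂ) :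
    ∑ i, condState ρ σ (B i) = condState ρ σ (∑ i, B i) := by
  ext p q
  simp only [condState, Matrix.sum_apply, Matrix.of_apply, Finset.mul_sum]
  rw [Finset.sum_comm]
  refine Finset.sum_congr rfl fun j _ => ?_
  rw [Finset.sum_comm]
  refine Finset.sum_congr rfl fun j' _ => ?_
  rw [Finset.sum_comm]
  refine Finset.sum_congr rfl fun l _ => ?_
  rw [Finset.sum_comm]

theorem condState_one {a b₁ b₂ c : Type*} [Fintype b₁] [Fintype b₂] [DecidableEq b₁]
    [DecidableEq b₂] (ρ : Matrix (a × b₁) (a × b₁) ℂ)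
    (σ : Matrix (b₂ × c) (b₂ × c) ℂ) :
    condState ρ σ 1 = reduced ρ ⊗ₖ reduced (swapped σ) := by
  ext p q
  simp only [condState, Matrix.of_apply, Matrix.one_apply, Prod.mk.injEq, ite_and, mul_ite,
    mul_one, mul_zero, kroneckerMap_apply, reduced, swapped, Matrix.sum_apply, submatrix_apply,
    Prod.swap_prod_mk, Finset.sum_mul_sum]
  simp

/-- Multiplication by `p(b)` removes the normalisation of the postselected correlator. -/
theorem correlator_mul_centralProb {a b₁ b₂ c : Type*} [Fintype a] [Fintype b₁] [Fintype b₂]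
    [Fintype c] [DecidableEq a] [DecidableEq c] (ρ : Matrix (a × b₁) (a × b₁) ℂ)
    (σ : Matrix (b₂ × c) (b₂ × c) ℂ) (A : Fin 2 → Matrix a a ℂ)
    (B : Matrix (b₁ × b₂) (b₁ × b₂) ℂ) (C : Fin 2 → Matrix c c ℂ)
    (h : centralProb ρ σ B ≠ 0) :
    (condState ρ σ B * ((A 0 - A 1) ⊗ₖ (C 0 - C 1))).trace.re =
      correlator ρ σ A B C * centralProb ρ σ B := by
  have hexp : (A 0 - A 1) ⊗ₖ (C 0 - C 1) =
      A 0 ⊗ₖ C 0 - A 0 ⊗ₖ C 1 - A 1 ⊗ₖ C 0 + A 1 ⊗ₖ C 1 := by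
    ext p q
    simp only [kroneckerMap_apply, Matrix.sub_apply, Matrix.add_apply]
    ring
  simp only [hexp, correlator, Fin.sum_univ_two, Matrix.mul_add, Matrix.mul_sub, trace_add,
    trace_sub, Complex.add_re, Complex.sub_re, ← born_eq_trace_condState]
  field_simp
  simp
  ring

theorem centralProb_eq {a b₁ b₂ c : Type*} [Fintype a] [Fintype b₁] [Fintype b₂] [Fintype c]
    [DecidableEq a] [DecidableEq c] (ρ : Matrix (a × b₁) (a × b₁) ℂ)
    (σ : Matrix (b₂ × c) (b₂ × c) ℂ) (B : Matrix (b₁ × b₂) (b₁ × b₂) ℂ) :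
    centralProb ρ σ B = (condState ρ σ B).trace.re := by
  rw [centralProb, born_eq_trace_condState, one_kronecker_one, Matrix.mul_one]

/-- The operator with matrix `k ↦ F x (k, l)`, the row `x` of `F` being a vector of a tensor
product. -/
def slice {ι γ β : Type*} (F : Matrix ι (γ × β) ℂ) (x : ι) : Matrix γ β ℂ :=
  Matrix.of fun k l => F x (k, l)

/-- The Kraus operators of the teleportation channel that consumes the resource state `Fᴴ * F` and
has the effect `Gᴴ * G` as its measurement outcome, one for each rank-one term of the two. -/
def steerKraus {ι κ α β γ : Type*} [Fintype β] (F : Matrix ι (γ × β) ℂ)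
    (G : Matrix κ (α × β) ℂ) (p : ι × κ) : Matrix γ α ℂ :=
  (slice F p.1).map star * (slice G p.2)ᵀ

theorem krausMap_steerKraus_apply {ι κ α β γ : Type*} [Fintype ι] [Fintype κ] [Fintype α]
    [Fintype β] (F : Matrix ι (γ × β) ℂ) (G : Matrix κ (α × β) ℂ)
    (M : Matrix α α ℂ) (k k' : γ) :
    krausMap (steerKraus F G) M k k' = ∑ j, ∑ j', ∑ l, ∑ l',
      M j j' * (Fᴴ * F) (k, l) (k', l') * (Gᴴ * G) (j', l') (j, l) := by
  simp only [krausMap_apply, Matrix.sum_apply, Matrix.mul_apply, steerKraus, slice,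
    conjTranspose_apply, Matrix.map_apply, transpose_apply, Matrix.of_apply,
    Fintype.sum_prod_type, star_sum, star_mul', star_star, Finset.sum_mul, Finset.mul_sum]
  simp only [← Fintype.sum_prod_type']
  exact Finset.sum_nbij' (fun ⟨x, y, j', l', j, l⟩ => (j, j', l, l', y, x))
    (fun ⟨j, j', l, l', y, x⟩ => (x, y, j', l', j, l)) (by simp) (by simp)
    (by simp) (by simp) (by rintro ⟨x, y, j', l', j, l⟩ -; ring)

theorem sum_steerKraus_conj_mul {o ι κ α β γ : Type*} [Fintype o] [Fintype ι] [Fintype κ]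
    [Fintype β] [Fintype γ] [DecidableEq α] [DecidableEq β]
    {F : Matrix ι (γ × β) ℂ} {G : o → Matrix κ (α × β) ℂ} (hF : (Fᴴ * F).trace = 1)
    (hG : ∑ b, (G b)ᴴ * G b = 1) :
    ∑ b, ∑ p, (steerKraus F (G b) p)ᴴ * steerKraus F (G b) p = 1 := by
  have : ∀ b j' j, (∑ p, (steerKraus F (G b) p)ᴴ * steerKraus F (G b) p) j' j =
      ∑ k, ∑ l, ∑ l', (Fᴴ * F) (k, l) (k, l') * ((G b)ᴴ * G b) (j', l') (j, l) := by
    intro b j' j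
    simp only [Matrix.sum_apply, Matrix.mul_apply, steerKraus, slice,
      conjTranspose_apply, Matrix.map_apply, transpose_apply, Matrix.of_apply,
      Fintype.sum_prod_type, star_sum, star_mul', star_star, Finset.sum_mul, Finset.mul_sum]
    simp only [← Fintype.sum_prod_type']
    exact Finset.sum_nbij' (fun ⟨x, y, k, l, l'⟩ => (k, l, l', y, x))
      (fun ⟨k, l, l', y, x⟩ => (x, y, k, l, l')) (by simp) (by simp)
      (by simp) (by simp) (by rintro ⟨x, y, k, l, l'⟩ -; ring)
  ext j' j
  have hG' := fun l l' => congrFun (congrFun hG (j', l')) (j, l)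
  simp only [Matrix.sum_apply] at hG'
  rw [Matrix.sum_apply]
  simp only [this]
  calc _ = ∑ k, ∑ l, ∑ l', (Fᴴ * F) (k, l) (k, l') *
        ∑ b, ((G b)ᴴ * G b) (j', l') (j, l) := by
        rw [Finset.sum_comm]
        refine Finset.sum_congr rfl fun k _ => ?_
        rw [Finset.sum_comm]
        refine Finset.sum_congr rfl fun l _ => ?_
        rw [Finset.sum_comm]
        exact Finset.sum_congr rfl fun l' _ => (Finset.mul_sum _ _ _).symm
    _ = (Fᴴ * F).trace * (1 : Matrix α α ℂ) j' j := by
        simp only [hG', Matrix.one_apply, Prod.mk.injEq, ite_and, Matrix.trace, Matrix.diag,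
          Fintype.sum_prod_type]
        split_ifs <;> simp
    _ = _ := by rw [hF, one_mul]

/-- The conditional state arises from `ρ` by teleporting its second half with the help of `σ`. -/
theorem condState_eq_kronecker_steer {ι κ a b₁ b₂ c : Type*} [Fintype ι] [Fintype κ] [Fintype a]
    [Fintype b₁] [Fintype b₂] [Fintype c] [DecidableEq a] (ρ : Matrix (a × b₁) (a × b₁) ℂ)
    {σ : Matrix (b₂ × c) (b₂ × c) ℂ} {B : Matrix (b₁ × b₂) (b₁ × b₂) ℂ}
    {F : Matrix ι (c × b₂) ℂ} {G : Matrix κ (b₁ × b₂) ℂ} (hF : swapped σ = Fᴴ * F)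
    (hG : B = Gᴴ * G) :
    condState ρ σ B = krausMap (fun p => (1 : Matrix a a ℂ) ⊗ₖ steerKraus F G p) ρ := by
  ext ⟨i, k⟩ ⟨i', k'⟩
  have := krausMap_steerKraus_apply F G (Matrix.of fun j j' => ρ (i, j) (i', j')) k k'
  rw [krausMap_apply, Matrix.sum_apply] at this
  simp only [krausMap_apply, Matrix.sum_apply, one_kronecker_conj_apply]
  rw [this, ← hF, ← hG]
  rfl

/-- The conditional state arises from `σ` by teleporting its first half with the help of `ρ`. -/
theorem condState_eq_steer_kronecker {ι κ a b₁ b₂ c : Type*} [Fintype ι] [Fintype κ] [Fintype a]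
    [Fintype b₁] [Fintype b₂] [Fintype c] [DecidableEq c] {ρ : Matrix (a × b₁) (a × b₁) ℂ}
    (σ : Matrix (b₂ × c) (b₂ × c) ℂ) {B : Matrix (b₁ × b₂) (b₁ × b₂) ℂ}
    {F : Matrix ι (a × b₁) ℂ} {G : Matrix κ (b₂ × b₁) ℂ} (hF : ρ = Fᴴ * F)
    (hG : swapped B = Gᴴ * G) :
    condState ρ σ B = krausMap (fun p => steerKraus F G p ⊗ₖ (1 : Matrix c c ℂ)) σ := by
  ext ⟨i, k⟩ ⟨i', k'⟩
  have := krausMap_steerKraus_apply F G (Matrix.of fun j j' => σ (j, k) (j', k')) i i'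
  rw [krausMap_apply, Matrix.sum_apply] at this
  simp only [krausMap_apply, Matrix.sum_apply, kronecker_one_conj_apply]
  rw [this, ← hF, ← hG]
  simp only [condState, Matrix.of_apply, swapped, submatrix_apply, Prod.swap_prod_mk]
  simp only [← Fintype.sum_prod_type']
  exact Finset.sum_nbij' (fun ⟨j, j', l, l'⟩ => (l, l', j, j'))
    (fun ⟨l, l', j, j'⟩ => (j, j', l, l')) (by simp) (by simp)
    (by simp) (by simp) (by rintro ⟨j, j', l, l'⟩ -; ring)

/-! ### The extraction channels -/

theorem sum_conj_mul_of_complete {o κ ι m n p : Type*} [Fintype o] [Fintype κ] [Fintype ι]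
    [Fintype m] [Fintype n] [DecidableEq m] [DecidableEq n] [DecidableEq p]
    {U : o → Matrix m m ℂ} {W : κ → Matrix m n ℂ} {K : o → ι → Matrix n p ℂ}
    (hU : ∀ b, (U b)ᴴ * U b = 1) (hW : ∑ l, (W l)ᴴ * W l = 1)
    (hK : ∑ b, ∑ i, (K b i)ᴴ * K b i = 1) :
    ∑ q : o × κ × ι, (U q.1 * (W q.2.1 * K q.1 q.2.2))ᴴ * (U q.1 * (W q.2.1 * K q.1 q.2.2)) =
      1 := by
  have h : ∀ b l i, (U b * (W l * K b i))ᴴ * (U b * (W l * K b i)) =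
      (K b i)ᴴ * ((W l)ᴴ * W l) * K b i := fun b l i => by
    rw [conjTranspose_mul, Matrix.mul_assoc, ← Matrix.mul_assoc (U b)ᴴ, hU, Matrix.one_mul,
      conjTranspose_mul]
    simp only [Matrix.mul_assoc]
  simp only [Fintype.sum_prod_type, h]
  rw [← hK]
  refine Finset.sum_congr rfl fun b _ => ?_
  rw [Finset.sum_comm]
  refine Finset.sum_congr rfl fun i _ => ?_
  rw [← Matrix.sum_mul, ← Matrix.mul_sum, hW, Matrix.mul_one]

open scoped MatrixOrder in
theorem exists_eq_conjTranspose_mul_self {n : Type*} [Fintype n] {M : Matrix n n ℂ}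
    (hM : M.PosSemidef) : ∃ F : Matrix n n ℂ, M = Fᴴ * F := by
  classical
  exact CStarAlgebra.nonneg_iff_eq_star_mul_self.1 hM.nonneg

section SelfTest

variable {HA HB₁ HB₂ HC κ κ' : Type*} [Fintype HA] [Fintype HB₁] [Fintype HB₂] [Fintype HC]
  [Fintype κ] [Fintype κ'] [DecidableEq HA] [DecidableEq HB₁] [DecidableEq HB₂] [DecidableEq HC]
  {ρ : Matrix (HA × HB₁) (HA × HB₁) ℂ} {σ : Matrix (HB₂ × HC) (HB₂ × HC) ℂ}
  {B : Fin 2 × Fin 2 → Matrix (HB₁ × HB₂) (HB₁ × HB₂) ℂ}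
  {V : κ → Matrix (Fin 2) HA ℂ} {W : κ' → Matrix (Fin 2) HC ℂ}

/-- The central party teleports its share of `ρ` to the last party with the help of `σ`, where the
Bell states are extracted and corrected. -/
theorem selfTestsPhiPlus_left (hσ : IsDensity σ) (hB : IsPOVM B)
    (hV : ∑ k, (V k)ᴴ * V k = 1) (hW : ∑ l, (W l)ᴴ * W l = 1)
    (h : ∀ b, ∑ k, ∑ l, (V k ⊗ₖ W l) * condState ρ σ (B b) * (V k ⊗ₖ W l)ᴴ =
      (1 / 4 : ℂ) • bellProj b) : SelfTestsPhiPlus ρ := by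
  obtain ⟨F, hF⟩ := exists_eq_conjTranspose_mul_self hσ.swapped.posSemidef
  choose G hG using fun b => exists_eq_conjTranspose_mul_self (hB.posSemidef b)
  have hK := sum_steerKraus_conj_mul (F := F) (G := G) (by rw [← hF, hσ.swapped.trace_eq_one])
    (by simp only [← hG, hB.sum_eq_one])
  refine selfTestsPhiPlus_of_kraus hV
    (sum_conj_mul_of_complete bellCorrection_conj_mul hW hK) ?_
  have hstep : ∀ b, ∑ k, ∑ l, ∑ i,
      (V k ⊗ₖ (bellCorrection b * (W l * steerKraus F (G b) i))) * ρ *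
        (V k ⊗ₖ (bellCorrection b * (W l * steerKraus F (G b) i)))ᴴ =
      (1 / 4 : ℂ) • bellProj (0, 0) := fun b => by
    rw [← one_kronecker_bellCorrection_conj b, ← Matrix.smul_mul, ← Matrix.mul_smul, ← h b,
      condState_eq_kronecker_steer ρ hF (hG b), krausMap_apply]
    simp only [Matrix.mul_sum, Matrix.sum_mul]
    refine Finset.sum_congr rfl fun k _ => Finset.sum_congr rfl fun l _ =>
      Finset.sum_congr rfl fun i _ => ?_
    have : V k ⊗ₖ (bellCorrection b * (W l * steerKraus F (G b) i)) =
        ((1 : Matrix (Fin 2) (Fin 2) ℂ) ⊗ₖ bellCorrection b) *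
          ((V k ⊗ₖ W l) * ((1 : Matrix HA HA ℂ) ⊗ₖ steerKraus F (G b) i)) := by
      rw [← mul_kronecker_mul, ← mul_kronecker_mul, Matrix.one_mul, Matrix.mul_one]
    rw [this]
    simp only [conjTranspose_mul, Matrix.mul_assoc]
  rw [krausMap_apply, Fintype.sum_prod_type]
  simp only [Fintype.sum_prod_type (α₁ := Fin 2 × Fin 2), Fintype.sum_prod_type (α₁ := κ')]
  rw [Finset.sum_comm]
  simp only [hstep, Finset.sum_const, Finset.card_univ, Fintype.card_prod, Fintype.card_fin]
  rw [← Nat.cast_smul_eq_nsmul ℂ, smul_smul]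
  norm_num

/-- The central party teleports its share of `σ` to the first party with the help of `ρ`, where the
Bell states are extracted and corrected. -/
theorem selfTestsPhiPlus_right (hρ : IsDensity ρ) (hB : IsPOVM B)
    (hV : ∑ k, (V k)ᴴ * V k = 1) (hW : ∑ l, (W l)ᴴ * W l = 1)
    (h : ∀ b, ∑ k, ∑ l, (V k ⊗ₖ W l) * condState ρ σ (B b) * (V k ⊗ₖ W l)ᴴ =
      (1 / 4 : ℂ) • bellProj b) : SelfTestsPhiPlus σ := by
  obtain ⟨F, hF⟩ := exists_eq_conjTranspose_mul_self hρ.posSemidef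
  choose G hG using fun b => exists_eq_conjTranspose_mul_self
    (show (swapped (B b)).PosSemidef from (hB.posSemidef b).submatrix _)
  have hone : ∑ b, swapped (B b) = 1 := by
    ext ⟨l, j⟩ ⟨l', j'⟩
    have := congrFun (congrFun hB.sum_eq_one (j, l)) (j', l')
    simp only [Matrix.sum_apply, swapped, submatrix_apply, Prod.swap_prod_mk] at this ⊢
    rw [this]
    simp [Matrix.one_apply, and_comm]
  have hK := sum_steerKraus_conj_mul (F := F) (G := G) (by rw [← hF, hρ.trace_eq_one])
    (by simp only [← hG, hone])
  refine selfTestsPhiPlus_of_kraus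
    (sum_conj_mul_of_complete bellCorrection_conj_mul hV hK) hW ?_
  have hstep : ∀ b, ∑ k, ∑ i, ∑ l,
      ((bellCorrection b * (V k * steerKraus F (G b) i)) ⊗ₖ W l) * σ *
        ((bellCorrection b * (V k * steerKraus F (G b) i)) ⊗ₖ W l)ᴴ =
      (1 / 4 : ℂ) • bellProj (0, 0) := fun b => by
    rw [← bellCorrection_kronecker_one_conj b, ← Matrix.smul_mul, ← Matrix.mul_smul, ← h b,
      condState_eq_steer_kronecker σ hF (hG b), krausMap_apply]
    simp only [Matrix.mul_sum, Matrix.sum_mul]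
    refine Finset.sum_congr rfl fun k _ => ?_
    rw [Finset.sum_comm]
    refine Finset.sum_congr rfl fun l _ => Finset.sum_congr rfl fun i _ => ?_
    have : (bellCorrection b * (V k * steerKraus F (G b) i)) ⊗ₖ W l =
        (bellCorrection b ⊗ₖ (1 : Matrix (Fin 2) (Fin 2) ℂ)) *
          ((V k ⊗ₖ W l) * (steerKraus F (G b) i ⊗ₖ (1 : Matrix HC HC ℂ))) := by
      rw [← mul_kronecker_mul, ← mul_kronecker_mul, Matrix.one_mul, Matrix.mul_one]
    rw [this]
    simp only [conjTranspose_mul, Matrix.mul_assoc]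
  rw [krausMap_apply, Fintype.sum_prod_type]
  simp only [Fintype.sum_prod_type (α₁ := Fin 2 × Fin 2), Fintype.sum_prod_type (α₁ := κ)]
  simp only [hstep, Finset.sum_const, Finset.card_univ, Fintype.card_prod, Fintype.card_fin]
  rw [← Nat.cast_smul_eq_nsmul ℂ, smul_smul]
  norm_num

end SelfTest

theorem map_star_mul_transpose_mul {m n : Type*} [Fintype n] (V : Matrix m n ℂ)
    (Y : Matrix n n ℂ) : V.map star * Yᵀ * (V.map star)ᴴ = (V * Y * Vᴴ)ᵀ := by
  rw [transpose_mul, transpose_mul, Matrix.mul_assoc]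
  congr 2
  ext i j
  simp

theorem sum_slice_mul_conjTranspose {ι α β : Type*} [Fintype ι] [Fintype β]
    (F : Matrix ι (α × β) ℂ) :
    ∑ x, slice F x * (slice F x)ᴴ = (reduced (Fᴴ * F))ᵀ := by
  ext i i'
  simp only [Matrix.sum_apply, Matrix.mul_apply, slice, reduced, conjTranspose_apply,
    transpose_apply, submatrix_apply, Matrix.of_apply]
  rw [Finset.sum_comm]
  exact Finset.sum_congr rfl fun j _ => Finset.sum_congr rfl fun x _ => mul_comm _ _

/-- The conditional state depends on the central effect through local completely positive maps, up
to a transposition. -/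
theorem condState_transpose {ι κ a b₁ b₂ c : Type*} [Fintype ι] [Fintype κ]
    [Fintype b₁] [Fintype b₂] {ρ : Matrix (a × b₁) (a × b₁) ℂ}
    {σ : Matrix (b₂ × c) (b₂ × c) ℂ} (B : Matrix (b₁ × b₂) (b₁ × b₂) ℂ)
    {F : Matrix ι (a × b₁) ℂ} {F' : Matrix κ (c × b₂) ℂ} (hF : ρ = Fᴴ * F)
    (hF' : swapped σ = F'ᴴ * F') :
    (condState ρ σ B)ᵀ = krausMap (fun p : ι × κ => slice F p.1 ⊗ₖ slice F' p.2) B := by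
  have hσ : ∀ l k l' k', σ (l, k) (l', k') = (F'ᴴ * F') (k, l) (k', l') := fun l k l' k' => by
    rw [← hF']
    rfl
  ext ⟨i, k⟩ ⟨i', k'⟩
  simp only [transpose_apply, condState, Matrix.of_apply, hσ, hF, krausMap_apply,
    Matrix.sum_apply, Matrix.mul_apply, slice, conjTranspose_apply, kroneckerMap_apply,
    Fintype.sum_prod_type, star_mul', Finset.sum_mul, Finset.mul_sum]
  simp only [← Fintype.sum_prod_type']
  exact Finset.sum_nbij' (fun ⟨j, j', l, l', y, x⟩ => (x, y, j, l, j', l'))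
    (fun ⟨x, y, j, l, j', l'⟩ => (j, j', l, l', y, x)) (by simp) (by simp)
    (by simp) (by simp) (by rintro ⟨j, j', l, l', y, x⟩ -; ring)

/-- The Kraus operators of the map that sends an effect `E` on the second half of the state `Fᴴ * F`
to the transpose of the operator that remains of the first half, after compression by `V`. The
factor `√2` makes the map unital when the extracted qubit is maximally mixed. -/
noncomputable def liftKraus {κ ι a b : Type*} [Fintype a] (V : κ → Matrix (Fin 2) a ℂ)
    (F : Matrix ι (a × b) ℂ) (p : κ × ι) : Matrix (Fin 2) b ℂ :=
  ((√2 : ℝ) : ℂ) • ((V p.1).map star * slice F p.2)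

theorem smul_mul_smul_conjTranspose {m n : Type*} [Fintype n] (K : Matrix m n ℂ)
    (X : Matrix n n ℂ) (r : ℝ) :
    ((r : ℂ) • K) * X * ((r : ℂ) • K)ᴴ = ((r : ℂ) * r) • (K * X * Kᴴ) := by
  rw [conjTranspose_smul, Complex.star_def, Complex.conj_ofReal, Matrix.smul_mul, Matrix.smul_mul,
    Matrix.mul_smul, smul_smul]

theorem isCPUnital_krausMap_liftKraus {κ ι a b : Type*} [Fintype κ] [Fintype ι] [Fintype a]
    [Fintype b] [DecidableEq b] {V : κ → Matrix (Fin 2) a ℂ} {F : Matrix ι (a × b) ℂ}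
    (h : ∑ k, V k * reduced (Fᴴ * F) * (V k)ᴴ = (1 / 2 : ℂ) • 1) :
    IsCPUnital (krausMap (liftKraus V F)) := by
  refine ⟨isCP_krausMap _, ?_⟩
  have : ∀ k, ∑ x, liftKraus V F (k, x) * (1 : Matrix b b ℂ) * (liftKraus V F (k, x))ᴴ =
      (2 : ℂ) • (V k * reduced (Fᴴ * F) * (V k)ᴴ)ᵀ := fun k => by
    rw [← map_star_mul_transpose_mul, ← sum_slice_mul_conjTranspose]
    simp only [liftKraus, smul_mul_smul_conjTranspose, sqrt_two_mul_self, Matrix.mul_sum,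
      Matrix.sum_mul, Finset.smul_sum]
    simp only [Matrix.mul_one, conjTranspose_mul, Matrix.mul_assoc]
  rw [krausMap_apply, Fintype.sum_prod_type]
  simp only [this]
  rw [← Finset.smul_sum, ← transpose_sum, h]
  ext i j
  fin_cases i <;> fin_cases j <;> simp

/-- The lifted maps turn the central effect into the state that is extracted from the conditional
state, up to transposition and normalisation. -/
theorem krausMap_liftKraus_kronecker {κ κ' ι ι' a b₁ b₂ c : Type*} [Fintype κ] [Fintype κ']
    [Fintype ι] [Fintype ι'] [Fintype a] [Fintype b₁] [Fintype b₂] [Fintype c]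
    {ρ : Matrix (a × b₁) (a × b₁) ℂ} {σ : Matrix (b₂ × c) (b₂ × c) ℂ}
    (B : Matrix (b₁ × b₂) (b₁ × b₂) ℂ) {F : Matrix ι (a × b₁) ℂ} {F' : Matrix ι' (c × b₂) ℂ}
    (hF : ρ = Fᴴ * F) (hF' : swapped σ = F'ᴴ * F') (V : κ → Matrix (Fin 2) a ℂ)
    (W : κ' → Matrix (Fin 2) c ℂ) :
    krausMap (fun p : (κ × ι) × (κ' × ι') => liftKraus V F p.1 ⊗ₖ liftKraus W F' p.2) B =
      (4 : ℂ) • (∑ k, ∑ l, (V k ⊗ₖ W l) * condState ρ σ B * (V k ⊗ₖ W l)ᴴ)ᵀ := by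
  have hstar : ∀ k l, (V k ⊗ₖ W l).map star = (V k).map star ⊗ₖ (W l).map star := fun k l => by
    ext p q
    simp
  have hlift : ∀ k x l y, liftKraus V F (k, x) ⊗ₖ liftKraus W F' (l, y) =
      ((2 : ℝ) : ℂ) • ((V k ⊗ₖ W l).map star * (slice F x ⊗ₖ slice F' y)) := fun k x l y => by
    rw [hstar, ← mul_kronecker_mul, liftKraus, liftKraus, smul_kronecker, kronecker_smul,
      smul_smul, sqrt_two_mul_self]
    norm_num
  simp only [transpose_sum, ← map_star_mul_transpose_mul, condState_transpose B hF hF',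
    krausMap_apply, Fintype.sum_prod_type, hlift, smul_mul_smul_conjTranspose, Finset.smul_sum,
    Matrix.mul_sum, Matrix.sum_mul]
  refine Finset.sum_congr rfl fun k _ => ?_
  rw [Finset.sum_comm]
  refine Finset.sum_congr rfl fun l _ => Finset.sum_congr rfl fun x _ =>
    Finset.sum_congr rfl fun y _ => ?_
  rw [conjTranspose_mul]
  simp only [Matrix.mul_assoc]
  norm_num

/-- The marginals of a maximally mixed product state are maximally mixed. -/
theorem eq_half_of_kronecker_eq {X Y : Matrix (Fin 2) (Fin 2) ℂ}
    (h : X ⊗ₖ Y = (1 / 4 : ℂ) • 1) (hX : X.trace = 1) (hY : Y.trace = 1) :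
    X = (1 / 2 : ℂ) • 1 ∧ Y = (1 / 2 : ℂ) • 1 := by
  have e := fun i k j l => congrFun (congrFun h (i, k)) (j, l)
  simp only [kroneckerMap_apply, Matrix.smul_apply, Matrix.one_apply, Prod.mk.injEq] at e
  rw [trace_fin_two] at hX hY
  constructor
  · ext i j
    have : X i j = X i j * Y 0 0 + X i j * Y 1 1 := by rw [← mul_add, hY, mul_one]
    rw [this, e, e, Matrix.smul_apply, Matrix.one_apply]
    by_cases hij : i = j
    · simp [hij]
      norm_num
    · simp [hij]
  · ext i j
    have : Y i j = X 0 0 * Y i j + X 1 1 * Y i j := by rw [← add_mul, hX, one_mul]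
    rw [this, e, e, Matrix.smul_apply, Matrix.one_apply]
    by_cases hij : i = j
    · simp [hij]
      norm_num
    · simp [hij]

end Bilocal

open Bilocal

theorem mainTheorem2 {HA HB₁ HB₂ HC : Type*}
    [Fintype HA] [Fintype HB₁] [Fintype HB₂] [Fintype HC]
    [DecidableEq HA] [DecidableEq HB₁] [DecidableEq HB₂] [DecidableEq HC]
    (ρ : Matrix (HA × HB₁) (HA × HB₁) ℂ) (σ : Matrix (HB₂ × HC) (HB₂ × HC) ℂ)
    (hρ : Bilocal.IsDensity ρ) (hσ : Bilocal.IsDensity σ)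
    (A : Fin 2 → Fin 2 → Matrix HA HA ℂ) (hA : ∀ x, Bilocal.IsPOVM (A x))
    (C : Fin 2 → Fin 2 → Matrix HC HC ℂ) (hC : ∀ z, Bilocal.IsPOVM (C z))
    (B : Fin 2 × Fin 2 → Matrix (HB₁ × HB₂) (HB₁ × HB₂) ℂ) (hB : Bilocal.IsPOVM B)
    (δ : ℝ) (hδ0 : δ ≠ 0) (hδ : |δ| ≤ Real.pi / 6)
    (hpos : ∀ b, 0 < Bilocal.centralProb ρ σ (B b))
    (h01 : ∀ b : Fin 2 × Fin 2,
      Bilocal.correlator ρ σ (A 0) (B b) (C 1) = (-1) ^ (b.1 : ℕ) * Real.cos δ)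
    (h10 : ∀ b : Fin 2 × Fin 2,
      Bilocal.correlator ρ σ (A 1) (B b) (C 0) = (-1) ^ (b.2 : ℕ) * Real.cos δ)
    (h00 : ∀ b : Fin 2 × Fin 2,
      Bilocal.correlator ρ σ (A 0) (B b) (C 0) = 0)
    (h11 : ∀ b : Fin 2 × Fin 2,
      Bilocal.correlator ρ σ (A 1) (B b) (C 1) =
        if b.1 = b.2 then (-1) ^ (b.1 : ℕ) * Real.sin (2 * δ) else 0) :
    (∃ (C₁ : Matrix HB₁ HB₁ ℂ →ₗ[ℂ] Matrix (Fin 2) (Fin 2) ℂ)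
      (C₂ : Matrix HB₂ HB₂ ℂ →ₗ[ℂ] Matrix (Fin 2) (Fin 2) ℂ),
      Bilocal.IsCPUnital C₁ ∧ Bilocal.IsCPUnital C₂ ∧
        ∀ b, Bilocal.tensorMap C₁ C₂ (B b) = Bilocal.bellProj b) ∧
    Bilocal.SelfTestsPhiPlus ρ ∧ Bilocal.SelfTestsPhiPlus σ := by
  obtain ⟨F, hF⟩ := exists_eq_conjTranspose_mul_self hρ.posSemidef
  obtain ⟨F', hF'⟩ := exists_eq_conjTranspose_mul_self hσ.swapped.posSemidef
  have hΩ : ∀ b, (condState ρ σ (B b)).PosSemidef := fun b => by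
    obtain ⟨G, hG⟩ := exists_eq_conjTranspose_mul_self (hB.posSemidef b)
    rw [condState_eq_kronecker_steer ρ hF' hG, krausMap_apply]
    exact posSemidef_sum _ fun p _ => hρ.posSemidef.mul_mul_conjTranspose_same _
  have hsum : ∑ b, condState ρ σ (B b) = reduced ρ ⊗ₖ reduced (swapped σ) := by
    rw [condState_sum, hB.sum_eq_one, condState_one]
  have hcorr : ∀ b x z, (condState ρ σ (B b) * ((A x 0 - A x 1) ⊗ₖ (C z 0 - C z 1))).trace.re =
      correlator ρ σ (A x) (B b) (C z) * (condState ρ σ (B b)).trace.re := fun b x z => by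
    rw [correlator_mul_centralProb ρ σ (A x) (B b) (C z) (hpos b).ne', centralProb_eq]
  obtain ⟨V, W, hV, hW, h⟩ := exists_bell_extraction hA hC hΩ hρ.reduced hσ.swapped.reduced hsum
    (fun b => by rw [← centralProb_eq]; exact hpos b) hδ0 hδ
    (fun b => by rw [hcorr, h00, zero_mul]) (fun b => by rw [hcorr, h01])
    (fun b => by rw [hcorr, h10]) (fun b => by rw [hcorr, h11])
  refine ⟨?_, selfTestsPhiPlus_left hσ hB hV hW h, selfTestsPhiPlus_right hρ hB hV hW h⟩
  -- without conditioning the extracted qubits are maximally mixed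
  have hmixed : (∑ k, V k * reduced ρ * (V k)ᴴ) ⊗ₖ (∑ l, W l * reduced (swapped σ) * (W l)ᴴ) =
      (1 / 4 : ℂ) • 1 := by
    rw [← sum_bellProj, Finset.smul_sum (r := (1 / 4 : ℂ)), ← sum_kronecker_sum]
    simp only [← h]
    symm
    rw [Finset.sum_comm]
    refine Finset.sum_congr rfl fun k _ => ?_
    rw [Finset.sum_comm]
    refine Finset.sum_congr rfl fun l _ => ?_
    rw [← Matrix.sum_mul, ← Matrix.mul_sum, hsum, conjTranspose_kronecker, ← mul_kronecker_mul,
      ← mul_kronecker_mul]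
  obtain ⟨hVρ, hWσ⟩ := eq_half_of_kronecker_eq hmixed
    (((isChannel_krausMap hV).trace_map _).trans hρ.reduced.trace_eq_one)
    (((isChannel_krausMap hW).trace_map _).trans hσ.swapped.reduced.trace_eq_one)
  rw [hF] at hVρ
  rw [hF'] at hWσ
  refine ⟨krausMap (liftKraus V F), krausMap (liftKraus W F'), isCPUnital_krausMap_liftKraus hVρ,
    isCPUnital_krausMap_liftKraus hWσ, fun b => ?_⟩
  rw [tensorMap_krausMap, krausMap_liftKraus_kronecker (B b) hF hF', h, transpose_smul,
    bellProj_transpose, smul_smul]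
  norm_num
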